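/- Identify a CNOT circuit on $n$ wires with a finite sequence of gates; a gate with control wire $i$ and target wire $j\neq i$ replaces the value of wire $j$ by the sum over $\mathbb F_2$ of the values of wires $i$ and $j$. The size of a circuit is its number of gates. A circuit whose wires are the vertices of a finite simple graph $G$ is a graphic parity network for $G$ if, for every input $x\in\mathbb F_2^{V(G)}$, the final values of the wires equal the input values, and for every edge $uv$ of $G$ there is a point of the circuit at which some wire carries $x_u\oplus x_v$ (for all inputs $x$). There is a randomized algorithm with worst-case running time polynomial in $n$ that, given a graph $G$ with $n$ vertices and $m$ edges, always outputs a graphic parity network for $G$, and whose output has expected size (over the random choices of the algorithm) $$m + O\left(n^{1.5}\sqrt{\log n}\right),$$ where the implied constant is absolute. Moreover, if all but a constant number of vertices have degree $\Omega(n)$, the network output by the same algorithm has expected size $m+O(n\log n)$; that is, for every integer $c_1\ge 0$ and every real $c_2>0$ there is a constant $K$ such that the expected size is at most $m+K\,n\log n$ on every graph $G$ in which at most $c_1$ vertices have degree less than $c_2 n$. -/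

import Mathlib

open scoped BigOperators

/-! ## CNOT circuits and parity networks -/

/-- A CNOT gate on wires `V`: two distinct wires, the control and the target. -/
structure CNOTGate (V : Type) where
  control : V
  target : V
  ne : control ≠ target

/-- A CNOT circuit is a finite sequence of CNOT gates; its size is the length of the list. -/
abbrev CNOTCircuit (V : Type) : Type := List (CNOTGate V)

/-- A CNOT gate adds (over `𝔽₂`) the value of the control wire to the target wire. -/
def CNOTGate.apply {V : Type} [DecidableEq V] (g : CNOTGate V) (x : V → ZMod 2) : V → ZMod 2 :=
  Function.update x g.target (x g.control + x g.target)

/-- The values of the wires after the gates of `C` were applied, from left to right, to `x`. -/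
def CNOTCircuit.run {V : Type} [DecidableEq V] (C : CNOTCircuit V) (x : V → ZMod 2) :
    V → ZMod 2 :=
  C.foldl (fun y g => g.apply y) x

/-- The term `A` appears in `C`: at some point of the circuit, some wire carries
`⊕ a ∈ A, x a`, whatever the input `x` is. -/
def CNOTCircuit.HasTerm {V : Type} [DecidableEq V] (C : CNOTCircuit V) (A : Finset V) : Prop :=
  ∃ D : CNOTCircuit V, D <+: C ∧ ∃ w : V, ∀ x : V → ZMod 2, D.run x w = ∑ a ∈ A, x a

/-- `C` is a parity network for the set family `S`: every member of `S` appears as a term, and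
the final values of the wires are the input values. -/
def CNOTCircuit.IsParityNetwork {V : Type} [DecidableEq V] (C : CNOTCircuit V)
    (S : Set (Finset V)) : Prop :=
  (∀ A ∈ S, C.HasTerm A) ∧ ∀ x : V → ZMod 2, C.run x = x

/-- `C` is a graphic parity network for `G`: a parity network for the family of the
two-element sets `{u, v}` where `uv` is an edge of `G`; there is one wire for each vertex. -/
def CNOTCircuit.IsGraphicParityNetwork {V : Type} [DecidableEq V] (C : CNOTCircuit V)
    (G : SimpleGraph V) : Prop :=
  C.IsParityNetwork {A | ∃ u v : V, G.Adj u v ∧ A = {u, v}}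

/-! ## Randomized random-access machines

Programs over registers and arrays of natural numbers. The only arithmetic operations are
addition and truncated subtraction, so that in `t` steps only numbers with `O(t)` bits more than
the input numbers arise, and polynomial time is the same as polynomial time on (probabilistic)
Turing machines. Randomness comes from fair coins. -/

/-- Arithmetic expressions. -/
inductive RAMExpr : Type
  /-- a constant -/
  | const (k : ℕ)
  /-- the content of register `r` -/
  | reg (r : ℕ)
  /-- the entry of array `a` at a computed index -/
  | entry (a : ℕ) (i : RAMExpr)
  /-- sum -/
  | add (e f : RAMExpr)
  /-- truncated difference -/
  | sub (e f : RAMExpr)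

/-- Programs. -/
inductive RAMProgram : Type
  /-- set register `r` to the value of `e` -/
  | assign (r : ℕ) (e : RAMExpr)
  /-- set the entry of array `a` at the index `i` to the value of `e` -/
  | store (a : ℕ) (i e : RAMExpr)
  /-- set register `r` to the outcome, `0` or `1`, of a fair coin toss -/
  | coin (r : ℕ)
  /-- append the value of `e` to the output -/
  | write (e : RAMExpr)
  /-- do nothing -/
  | skip
  /-- sequential composition -/
  | seq (p q : RAMProgram)
  /-- if `e < f` then `p` else `q` -/
  | ifLt (e f : RAMExpr) (p q : RAMProgram)
  /-- while `e < f` do `p` -/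
  | whileLt (e f : RAMExpr) (p : RAMProgram)

/-- States of the machine: the registers, the arrays, the outcomes of the coin tosses still to
be made, and the output written so far. -/
structure RAMState : Type where
  reg : ℕ → ℕ
  arr : ℕ → ℕ → ℕ
  coins : List Bool
  out : List ℕ

/-- The value of an expression. -/
def RAMExpr.eval (s : RAMState) : RAMExpr → ℕ
  | .const k => k
  | .reg r => s.reg r
  | .entry a i => s.arr a (i.eval s)
  | .add e f => e.eval s + f.eval s
  | .sub e f => e.eval s - f.eval s

/-- `RAMProgram.Exec p s t s'`: started in state `s`, the program `p` halts after exactly `t`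
steps, in state `s'`. Each elementary instruction and each evaluation of a test is one step
(it stands for a number of machine operations that depends only on the program). -/
inductive RAMProgram.Exec : RAMProgram → RAMState → ℕ → RAMState → Prop
  | assign (r : ℕ) (e : RAMExpr) (s : RAMState) :
      Exec (.assign r e) s 1 { s with reg := Function.update s.reg r (e.eval s) }
  | store (a : ℕ) (i e : RAMExpr) (s : RAMState) :
      Exec (.store a i e) s 1
        { s with arr := Function.update s.arr a
                          (Function.update (s.arr a) (i.eval s) (e.eval s)) }
  | coin (r : ℕ) (b : Bool) (l : List Bool) (s : RAMState) (h : s.coins = b :: l) :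
      Exec (.coin r) s 1 { s with reg := Function.update s.reg r b.toNat, coins := l }
  | write (e : RAMExpr) (s : RAMState) :
      Exec (.write e) s 1 { s with out := s.out ++ [e.eval s] }
  | skip (s : RAMState) : Exec .skip s 1 s
  | seq {p q : RAMProgram} {s s' s'' : RAMState} {t t' : ℕ}
      (hp : Exec p s t s') (hq : Exec q s' t' s'') : Exec (.seq p q) s (t + t') s''
  | if_true {e f : RAMExpr} {p q : RAMProgram} {s s' : RAMState} {t : ℕ}
      (h : e.eval s < f.eval s) (hp : Exec p s t s') : Exec (.ifLt e f p q) s (t + 1) s'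
  | if_false {e f : RAMExpr} {p q : RAMProgram} {s s' : RAMState} {t : ℕ}
      (h : ¬ e.eval s < f.eval s) (hq : Exec q s t s') : Exec (.ifLt e f p q) s (t + 1) s'
  | while_true {e f : RAMExpr} {p : RAMProgram} {s s' s'' : RAMState} {t t' : ℕ}
      (h : e.eval s < f.eval s) (hp : Exec p s t s') (hw : Exec (.whileLt e f p) s' t' s'') :
      Exec (.whileLt e f p) s (t + t' + 1) s''
  | while_false {e f : RAMExpr} {p : RAMProgram} {s : RAMState}
      (h : ¬ e.eval s < f.eval s) : Exec (.whileLt e f p) s 1 s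

/-! ## Graphs as inputs and circuits as outputs -/

/-- The initial state on input `G` when the coin tosses will show `coins`: register `0` holds
the number `n` of vertices, array `0` holds the adjacency matrix row by row, and everything else
is zero or empty. -/
def RAMState.init {n : ℕ} (G : SimpleGraph (Fin n)) [DecidableRel G.Adj] (coins : List Bool) :
    RAMState where
  reg r := if r = 0 then n else 0
  arr a k := if a = 0 ∧ ∃ i j : Fin n, G.Adj i j ∧ k = (i : ℕ) * n + (j : ℕ) then 1 else 0
  coins := coins
  out := []

/-- A circuit written as the sequence `control, target, control, target, …`. -/
def CNOTCircuit.encode {n : ℕ} (C : CNOTCircuit (Fin n)) : List ℕ :=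
  C.flatMap fun g => [(g.control : ℕ), (g.target : ℕ)]

/-- On input `G` and coin tosses `coins`, the program `P` halts within `t` steps and its output
is the circuit `C`. -/
def RAMProgram.OutputsWithin (P : RAMProgram) {n : ℕ} (G : SimpleGraph (Fin n))
    [DecidableRel G.Adj] (coins : List Bool) (t : ℕ) (C : CNOTCircuit (Fin n)) : Prop :=
  ∃ t' ≤ t, ∃ s : RAMState, P.Exec (RAMState.init G coins) t' s ∧ s.out = C.encode

/-- The expected size of the circuit `C ω` for the outcome `ω` of `R` independent fair coin
tosses. -/
noncomputable def expectedSize {V : Type} {R : ℕ} (C : (Fin R → Bool) → CNOTCircuit V) : ℝ :=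
  𝔼 ω : Fin R → Bool, ((C ω).length : ℝ)

/-!
The vertices are treated one after the other. Before and after each treatment, a treated wire
carries its own input, and an untreated wire `w` carries the sum of its own input and that of
`last w`, its most recently treated neighbour (just its own input as long as there is none). To
treat `v`, a gate from `last v` makes `v` carry its own input. Then, for each `o` for which some
untreated neighbours of `v` have `last w = o`, a gate from `o` to `v`, gates from `v` to all these
`w`, and the gate from `o` to `v` again replace the summand of `o` by that of `v` in the wires `w`,
which so come to carry the term of the edge `vw`. This takes one gate for each edge, at most one for
each vertex, and two for each *link*, a pair of vertices that are treated consecutively among the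
neighbours of some vertex.

To count links, cut the order into blocks of length `s`. A link either joins equal or adjacent
blocks or skips a whole block. In every order there are `O(n s)` links of the first kind, and
`O(n ^ 2 / s)` of the second as each vertex `w` contributes at most one for each skipped block;
`s = √n` gives `O(n ^ (3 / 2))`. If the order comes from independent random labels, a vertex of
degree at least `c₂ n` has neighbours in all blocks of `s ≈ 4 (log n) / c₂` labels with probability
`1 - O(1 / n)`, so that only `O(n log n)` links are to be expected. For the random labels, the
machine tosses `⌈log₂ n⌉` coins at each vertex.
-/

namespace CNOTCircuit

open scoped Finset

lemma length_eq_zero {V : Type} [Subsingleton V] (C : CNOTCircuit V) : C.length = 0 := by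
  rw [List.length_eq_zero_iff, List.eq_nil_iff_forall_not_mem]
  exact fun g _ => g.ne (Subsingleton.elim _ _)

section

variable {V : Type} [DecidableEq V]

/-- The circuit consisting of the gate with control `a` and target `b`, empty if `a = b`. -/
def gate (a b : V) : CNOTCircuit V :=
  if h : a ≠ b then [⟨a, b, h⟩] else []

/-- The circuit that adds to `v` the wire named by `o`, if there is one. -/
def load (o : Option V) (v : V) : CNOTCircuit V :=
  o.elim [] (gate · v)

/-- The circuit that adds to each wire in `W` the wire `v` and the wire named by `o`, passing the
latter through `v`, so that it costs only two gates on top of the gates from `v`. -/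
def addVia (o : Option V) (v : V) (W : List V) : CNOTCircuit V :=
  if W = [] then [] else load o v ++ (W.flatMap (gate v) ++ load o v)

/-- The circuit that adds to each wire `w` in `L` with `last w ∈ I` the wire `v` and the wire named
by `last w`. If every wire of `L` carries `x w + x (last w)`, it replaces these values by
`x w + x v`. -/
def exchange (last : V → Option V) (v : V) (L : List V) (I : List (Option V)) : CNOTCircuit V :=
  I.flatMap fun o => addVia o v (L.filter (last · = o))

lemma run_append (C D : CNOTCircuit V) (x : V → ZMod 2) :
    CNOTCircuit.run (C ++ D) x = D.run (C.run x) :=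
  List.foldl_append

lemma run_gate {a b : V} (h : a ≠ b) (x : V → ZMod 2) :
    (gate a b).run x = Function.update x b (x a + x b) := by
  simp [gate, h, CNOTCircuit.run, CNOTGate.apply]

lemma length_gate_le (a b : V) : (gate a b).length ≤ 1 := by
  unfold gate; split <;> simp

lemma run_load {o : Option V} {v : V} (h : ∀ i ∈ o, i ≠ v) (x : V → ZMod 2) :
    (load o v).run x = Function.update x v (o.elim 0 x + x v) := by
  cases o with
  | none => simp [load, CNOTCircuit.run]
  | some i => exact run_gate (h i rfl) x

lemma length_load_le (o : Option V) (v : V) : (load o v).length ≤ if o = none then 0 else 1 := by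
  cases o with
  | none => simp [load]
  | some i => simpa [load] using length_gate_le i v

lemma HasTerm.append {C : CNOTCircuit V} {A : Finset V} (h : C.HasTerm A) (D : CNOTCircuit V) :
    CNOTCircuit.HasTerm (C ++ D) A := by
  obtain ⟨E, hE, w, hw⟩ := h
  exact ⟨E, hE.trans (List.prefix_append _ _), w, hw⟩

lemma run_flatMap_gate {v : V} {W : List V} (hv : v ∉ W) (hW : W.Nodup) (y : V → ZMod 2) :
    CNOTCircuit.run (W.flatMap (gate v)) y = fun w => if w ∈ W then y v + y w else y w := by
  induction W generalizing y with
  | nil => simp [CNOTCircuit.run]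
  | cons a W ih =>
    simp only [List.mem_cons, not_or, List.nodup_cons] at hv hW
    rw [List.flatMap_cons, run_append, ih hv.2 hW.2, run_gate hv.1]
    funext w
    by_cases h : w = a
    · subst h; simp [hW.1]
    · simp [h, Function.update_of_ne hv.1]

lemma length_flatMap_gate_le (v : V) (W : List V) : (W.flatMap (gate v)).length ≤ W.length := by
  induction W with
  | nil => simp
  | cons a W ih =>
    have := length_gate_le v a
    simp only [List.flatMap_cons, List.length_append, List.length_cons]
    omega

lemma run_addVia {o : Option V} {v : V} {W : List V} (hv : v ∉ W) (hW : W.Nodup)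
    (ho : W ≠ [] → ∀ i ∈ o, i ≠ v ∧ i ∉ W) (y : V → ZMod 2) :
    (addVia o v W).run y = fun w => if w ∈ W then o.elim 0 y + y v + y w else y w := by
  by_cases hnil : W = []
  · simp [addVia, hnil, CNOTCircuit.run]
  have hne : ∀ i ∈ o, i ≠ v := fun i hi => (ho hnil i hi).1
  rw [addVia, if_neg hnil, run_append, run_append, run_load hne, run_flatMap_gate hv hW,
    run_load hne]
  funext w
  have hcancel (a b : ZMod 2) : a + (a + b) = b := by
    rw [← add_assoc, CharTwo.add_self_eq_zero, zero_add]
  cases o with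
  | none => by_cases hwv : w = v <;> simp [hwv, hv]
  | some i =>
    obtain ⟨hiv, hiW⟩ := ho hnil i rfl
    by_cases hwv : w = v
    · simp [hwv, hv, hiv, hiW, hcancel]
    · by_cases hw : w ∈ W <;> simp [hwv, hw]

lemma length_addVia_le (o : Option V) (v : V) (W : List V) :
    (addVia o v W).length ≤ W.length + if W ≠ [] ∧ o ≠ none then 2 else 0 := by
  have hW := length_flatMap_gate_le v W
  have ho := length_load_le o v
  unfold addVia
  split_ifs at ho ⊢ <;> simp_all
  omega

lemma run_exchange {last : V → Option V} {v : V} {L : List V} {I : List (Option V)}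
    (hI : I.Nodup) (hL : L.Nodup) (hv : v ∉ L)
    (hlast : ∀ w ∈ L, ∀ i ∈ last w, i ≠ v ∧ i ∉ L) (y : V → ZMod 2) :
    (exchange last v L I).run y = fun w =>
      if w ∈ L ∧ last w ∈ I then (last w).elim 0 y + y v + y w else y w := by
  induction I generalizing y with
  | nil => simp [exchange, CNOTCircuit.run]
  | cons a I ih =>
    rw [List.nodup_cons] at hI
    have hround := run_addVia (o := a) (v := v) (W := L.filter (last · = a)) (by simp [hv])
      (hL.filter _) (fun hne i hi => by
        obtain ⟨w, hw⟩ := List.exists_mem_of_ne_nil _ hne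
        simp only [List.mem_filter, decide_eq_true_eq] at hw ⊢
        have := hlast w hw.1 i (hw.2 ▸ hi)
        exact ⟨this.1, fun h => this.2 h.1⟩) y
    rw [exchange, List.flatMap_cons, run_append, hround]
    refine (ih hI.2 _).trans (funext fun w => ?_)
    by_cases hw : w ∈ L
    · have hload : ∀ z, (∀ i ∉ L, z i = y i) → (last w).elim 0 z = (last w).elim 0 y := by
        intro z hz
        have := hlast w hw
        cases hlw : last w with
        | none => rfl
        | some i => exact hz i (this i hlw).2
      rw [hload _ fun i hi => by simp [hi]]
      by_cases hwa : last w = a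
      · simp [hw, hwa, hI.1]
      · simp [hw, hv, hwa]
    · simp [hw]

lemma length_exchange_le (last : V → Option V) (v : V) {L : List V} {I : List (Option V)}
    (hI : I.Nodup) (hL : L.Nodup) :
    (exchange last v L I).length ≤ L.length + 2 * #(L.filterMap last).toFinset := by
  let served : Finset (Option V) := {o ∈ I.toFinset | L.filter (last · = o) ≠ [] ∧ o ≠ none}
  have hserved : #served ≤ #(L.filterMap last).toFinset := by
    refine (Finset.card_le_card fun o ho => ?_).trans (Finset.card_image_le (f := some))
    simp only [served, Finset.mem_filter] at ho
    obtain ⟨-, hne, ho⟩ := ho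
    obtain ⟨w, hw⟩ := List.exists_mem_of_ne_nil _ hne
    obtain ⟨i, rfl⟩ := Option.ne_none_iff_exists'.1 ho
    simp only [List.mem_filter, decide_eq_true_eq] at hw
    simpa using ⟨w, hw⟩
  calc (exchange last v L I).length
      = ∑ o ∈ I.toFinset, (addVia o v (L.filter (last · = o))).length := by
        rw [exchange, List.length_flatMap, List.sum_toFinset _ hI]
    _ ≤ ∑ o ∈ I.toFinset, (#{w ∈ L.toFinset | last w = o} +
          if L.filter (last · = o) ≠ [] ∧ o ≠ none then 2 else 0) := by
        refine Finset.sum_le_sum fun o _ => (length_addVia_le _ _ _).trans_eq ?_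
        rw [← List.toFinset_card_of_nodup (hL.filter _), List.toFinset_filter]
        simp
    _ = #{w ∈ L.toFinset | last w ∈ I.toFinset} + #served * 2 := by
        rw [Finset.sum_add_distrib, Finset.sum_card_fiberwise_eq_card_filter,
          ← Finset.sum_filter, Finset.sum_const, smul_eq_mul]
    _ ≤ L.length + 2 * #(L.filterMap last).toFinset := by
        have := (Finset.card_filter_le L.toFinset (last · ∈ I.toFinset)).trans L.toFinset_card_le
        omega

end

end CNOTCircuit

namespace Sweep

open scoped Finset

section

variable {V : Type*} {G : SimpleGraph V} {pos : V → ℕ}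

/-- The vertex `i` is the neighbour of `w` with the largest position below `k`: when the vertices
are treated in the order of their positions, it is the neighbour of `w` treated most recently when
time `k` comes. -/
def IsLast (G : SimpleGraph V) (pos : V → ℕ) (w : V) (k : ℕ) (i : V) : Prop :=
  G.Adj w i ∧ pos i < k ∧ ∀ u, G.Adj w u → pos u < k → pos u ≤ pos i

lemma IsLast.unique (hpos : pos.Injective) {w i j : V} {k : ℕ} (hi : IsLast G pos w k i)
    (hj : IsLast G pos w k j) : i = j :=
  hpos (le_antisymm (hj.2.2 i hi.1 hi.2.1) (hi.2.2 j hj.1 hj.2.1))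

variable [Fintype V]

open Classical in
/-- The links into `v`: the vertices that directly precede `v` in the list of the neighbours of
some vertex. Each of them costs the circuit two gates. -/
noncomputable def links (G : SimpleGraph V) (pos : V → ℕ) (v : V) : Finset V :=
  {i | ∃ w, G.Adj w v ∧ IsLast G pos w (pos v) i}

lemma mem_links {v i : V} : i ∈ links G pos v ↔ ∃ w, G.Adj w v ∧ IsLast G pos w (pos v) i := by
  simp [links]

/-- The vertices that precede `v` in the same block or in the block before, where the values of
`r` are cut into blocks of length `s`. -/
def near (r : V → ℕ) (s : ℕ) (v : V) : Finset V :=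
  {i | r i ≤ r v ∧ r v / s ≤ r i / s + 1}

open Classical in
/-- The neighbours of `w` that lie at least two blocks after the preceding neighbour of `w`, where
the values of `r` are cut into blocks of length `s`. -/
noncomputable def jumps (G : SimpleGraph V) (pos r : V → ℕ) (s : ℕ) (w : V) : Finset V :=
  {v | G.Adj w v ∧ ∃ i, IsLast G pos w (pos v) i ∧ r i / s + 1 < r v / s}

section

variable {r : V → ℕ} (hr : ∀ u v, pos u ≤ pos v → r u ≤ r v)

include hr

open Classical in
lemma card_links_le (hpos : pos.Injective) (s : ℕ) (v : V) :
    #(links G pos v) ≤ #(near r s v) + #{w | v ∈ jumps G pos r s w} := by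
  have hfar : #(links G pos v \ near r s v) ≤ #{w | v ∈ jumps G pos r s w} := by
    refine Finset.card_le_card_of_forall_subsingleton
      (fun i w => IsLast G pos w (pos v) i) (fun i hi => ?_) fun w _ i hi j hj =>
        IsLast.unique hpos hi.2 hj.2
    simp only [mem_links, near, jumps, Finset.mem_sdiff, Finset.mem_filter_univ] at hi ⊢
    obtain ⟨⟨w, hwv, hl⟩, hfar⟩ := hi
    have hiv := hr i v hl.2.1.le
    exact ⟨w, ⟨hwv, i, hl, by grind⟩, hl⟩
  have := Finset.card_le_card_sdiff_add_card (s := links G pos v) (t := near r s v)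
  omega

lemma sum_card_links_le (hpos : pos.Injective) (s : ℕ) :
    ∑ v, #(links G pos v) ≤
      ∑ v, #(near r s v) + ∑ w, #(jumps G pos r s w) := by
  classical
  refine (Finset.sum_le_sum fun v _ => card_links_le (G := G) hr hpos s v).trans_eq ?_
  rw [Finset.sum_add_distrib]
  congr 1
  simp only [Finset.card_filter]
  rw [Finset.sum_comm]
  simp

lemma card_jumps_le (hpos : pos.Injective) {m : ℕ} (hm : ∀ v, r v ≤ m) (s : ℕ) (w : V) :
    #(jumps G pos r s w) ≤ m / s + 1 := by
  have hlt : ∀ u ∈ jumps G pos r s w, ∀ v ∈ jumps G pos r s w, pos u < pos v →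
      r u / s < r v / s := by
    intro u hu v hv huv
    simp only [jumps, Finset.mem_filter_univ] at hu hv
    obtain ⟨-, i, hi, hjump⟩ := hv
    have := Nat.div_le_div_right (c := s) (hr u i (hi.2.2 u hu.1 huv))
    omega
  rw [← Finset.card_range (m / s + 1)]
  refine Finset.card_le_card_of_injOn (fun v => r v / s) (fun v _ => ?_) fun u hu v hv h => ?_
  · simpa [Nat.lt_succ_iff] using Nat.div_le_div_right (hm v)
  · rcases lt_trichotomy (pos u) (pos v) with huv | huv | huv
    · exact absurd h (hlt u hu v hv huv).ne
    · exact hpos huv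
    · exact absurd h (hlt v hv u hu huv).ne'

lemma jumps_eq_empty {B s : ℕ} {w : V} (hB : ∀ v, r v < B)
    (hw : ∀ b < B / s, ∃ u, G.Adj w u ∧ r u / s = b) : jumps G pos r s w = ∅ := by
  rw [Finset.eq_empty_iff_forall_notMem]
  intro v hv
  simp only [jumps, Finset.mem_filter_univ] at hv
  obtain ⟨-, i, hi, hjump⟩ := hv
  have hblock := Nat.div_le_div_right (c := s) (hB v).le
  obtain ⟨u, hu, hub⟩ := hw (r i / s + 1) (by omega)
  rcases lt_or_ge (pos u) (pos v) with h | h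
  · have := Nat.div_le_div_right (c := s) (hr u i (hi.2.2 u hu h))
    omega
  · have := Nat.div_le_div_right (c := s) (hr v u h)
    omega

end

lemma card_filter_near_le {α : Type*} [Fintype α] {f : α → ℕ} (hf : f.Injective) {s : ℕ}
    (hs : 0 < s) (x : ℕ) : #{a | f a ≤ x ∧ x / s ≤ f a / s + 1} ≤ 2 * s := by
  calc #{a | f a ≤ x ∧ x / s ≤ f a / s + 1} ≤ #(Finset.Icc (x + 1 - 2 * s) x) := by
        refine Finset.card_le_card_of_injOn f (fun a ha => ?_) hf.injOn
        simp only [Finset.coe_filter_univ, Set.mem_ofPred_eq] at ha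
        have hx := Nat.lt_div_mul_add hs (a := x)
        have ha' := Nat.div_mul_le_self (f a) s
        have := Nat.mul_le_mul_right s ha.2
        rw [Finset.coe_Icc, Set.mem_Icc]
        constructor <;> grind
    _ ≤ 2 * s := by
        rw [Nat.card_Icc]
        omega

lemma sum_card_later_neighbors_le (G : SimpleGraph V) [DecidableRel G.Adj] (pos : V → ℕ) :
    ∑ v, #{w | G.Adj v w ∧ pos v < pos w} ≤ #G.edgeFinset := by
  classical
  rw [← Finset.card_sigma]
  refine Finset.card_le_card_of_injOn (fun p => s(p.1, p.2)) ?_ ?_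
  · rintro ⟨a, b⟩ hp
    simp only [Finset.coe_sigma, Set.mem_sigma_iff, Finset.coe_filter_univ, Set.mem_ofPred_eq] at hp
    simpa using hp.2.1
  · rintro ⟨a, b⟩ hp ⟨c, d⟩ hq hpq
    simp only [Finset.coe_sigma, Set.mem_sigma_iff, Finset.coe_filter_univ,
      Set.mem_ofPred_eq] at hp hq
    rcases Sym2.eq_iff.1 hpq with ⟨rfl, rfl⟩ | ⟨rfl, rfl⟩
    · rfl
    · exact absurd hp.2.2 hq.2.2.asymm

theorem sum_card_links_le_sqrt (G : SimpleGraph V) (hpos : pos.Injective)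
    (hlt : ∀ v, pos v < Fintype.card V) :
    ∑ v, #(links G pos v) ≤ 6 * (Fintype.card V * (Fintype.card V).sqrt) := by
  set n := Fintype.card V with hn
  rcases isEmpty_or_nonempty V with hV | hV
  · simp
  have hs : 0 < n.sqrt := Nat.sqrt_pos.2 Fintype.card_pos
  have hblocks : n / n.sqrt ≤ n.sqrt + 2 := by
    have := Nat.sqrt_le_add n
    exact Nat.div_le_of_le_mul (by linarith)
  calc ∑ v, #(links G pos v)
      ≤ ∑ v, #(near pos n.sqrt v) + ∑ w, #(jumps G pos pos n.sqrt w) :=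
        sum_card_links_le (fun _ _ h => h) hpos _
    _ ≤ ∑ _v : V, 2 * n.sqrt + ∑ _w : V, (n.sqrt + 3) := by
        gcongr with v _ w
        · exact card_filter_near_le hpos hs _
        · exact (card_jumps_le (fun _ _ h => h) hpos (fun v => (hlt v).le) _ w).trans (by omega)
    _ ≤ 6 * (n * n.sqrt) := by
        simp only [Finset.sum_const, Finset.card_univ, ← hn, smul_eq_mul]
        nlinarith

end

end Sweep

/-- The state of a sweep over the vertices: for each vertex its most recently treated neighbour,
whether it was treated itself, and the circuit built so far. -/
structure Sweep (n : ℕ) where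
  last : Fin n → Option (Fin n)
  done : Fin n → Bool
  circuit : CNOTCircuit (Fin n)

namespace Sweep

open CNOTCircuit
open scoped Finset

section

variable {n : ℕ} (G : SimpleGraph (Fin n)) [DecidableRel G.Adj]

/-- The sweep in which no vertex was treated yet. -/
def start (n : ℕ) : Sweep n := ⟨fun _ => none, fun _ => false, []⟩

/-- The untreated neighbours of `v`. -/
def guests (S : Sweep n) (v : Fin n) : List (Fin n) :=
  (List.finRange n).filter fun w => G.Adj v w ∧ S.done w = false

/-- The treatment of `v`: its wire gets its input value back, and each untreated neighbour `w` of
`v` gets the value `x w + x v`. -/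
def treat (S : Sweep n) (v : Fin n) : Sweep n where
  last w := if G.Adj v w then some v else S.last w
  done := Function.update S.done v true
  circuit := S.circuit ++ load (S.last v) v ++
    exchange S.last v (S.guests G v) ((List.finRange (n + 1)).map (finSuccEquiv n))

/-- A bound for the number of gates that the treatment of `v` adds. -/
noncomputable def cost (pos : Fin n → ℕ) (v : Fin n) : ℕ :=
  #{w | G.Adj v w ∧ pos v < pos w} + 1 + 2 * #(links G pos v)

/-- `S` is a state that the sweep can have when the vertices at the positions below `k` are
treated: treated wires carry their input values, and every other wire `w` carries
`x w + x (last w)`. -/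
structure Valid (pos : Fin n → ℕ) (k : ℕ) (S : Sweep n) : Prop where
  done_iff : ∀ u, S.done u = true ↔ pos u < k
  last_spec : ∀ w i, S.last w = some i → IsLast G pos w k i
  run : ∀ x w, S.circuit.run x w = x w + if S.done w then 0 else (S.last w).elim 0 x
  term : ∀ u w, G.Adj u w → pos u < k → S.circuit.HasTerm {u, w}
  length : S.circuit.length ≤ ∑ v with pos v < k, cost G pos v

variable {G} {pos : Fin n → ℕ} {k : ℕ} {S : Sweep n} {v : Fin n}

lemma mem_guests {w : Fin n} : w ∈ S.guests G v ↔ G.Adj v w ∧ S.done w = false := by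
  simp [guests]

lemma nodup_guests : (S.guests G v).Nodup :=
  (List.nodup_finRange n).filter _

lemma valid_start (G : SimpleGraph (Fin n)) [DecidableRel G.Adj] (pos : Fin n → ℕ) :
    Valid G pos 0 (start n) where
  done_iff := by simp [start]
  last_spec := by simp [start]
  run := by simp [start, CNOTCircuit.run]
  term := by simp
  length := by simp [start]

lemma Valid.done_of_last (h : Valid G pos k S) {w i : Fin n} (hi : S.last w = some i) :
    S.done i = true :=
  (h.done_iff i).2 (h.last_spec w i hi).2.1

section

variable (h : Valid G pos k S) (hv : pos v = k)

include h hv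

lemma Valid.done_eq_false : S.done v = false := by
  rw [← Bool.not_eq_true, h.done_iff]
  omega

lemma Valid.run_restore (x : Fin n → ZMod 2) (w : Fin n) :
    CNOTCircuit.run (S.circuit ++ load (S.last v) v) x w =
      x w + if (S.treat G v).done w then 0 else (S.last w).elim 0 x := by
  have hne : ∀ i ∈ S.last v, i ≠ v := fun i hi hiv => by
    simpa [hiv, h.done_eq_false hv] using h.done_of_last hi
  rw [run_append, run_load hne]
  by_cases hwv : w = v
  · subst hwv
    cases hl : S.last w with
    | none => simp [treat, h.run, hl]
    | some i =>
      simp [treat, h.run, hl, h.done_of_last hl, h.done_eq_false hv, add_left_comm,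
        CharTwo.add_self_eq_zero]
  · simp [treat, hwv, h.run]

lemma Valid.run_treat (x : Fin n → ZMod 2) (w : Fin n) :
    (S.treat G v).circuit.run x w =
      x w + if (S.treat G v).done w then 0 else ((S.treat G v).last w).elim 0 x := by
  have hlast : ∀ w ∈ S.guests G v, ∀ i ∈ S.last w, i ≠ v ∧ i ∉ S.guests G v := by
    intro w _ i hi
    have hid := h.done_of_last hi
    refine ⟨?_, fun hig => ?_⟩
    · rintro rfl
      simp [h.done_eq_false hv] at hid
    · simp [(mem_guests.1 hig).2] at hid
  have hI : ((List.finRange (n + 1)).map (finSuccEquiv n)).Nodup :=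
    (List.nodup_finRange _).map (finSuccEquiv n).injective
  have hload : (S.last w).elim 0 (CNOTCircuit.run (S.circuit ++ load (S.last v) v) x) =
      (S.last w).elim 0 x := by
    cases hl : S.last w with
    | none => rfl
    | some i => simp [h.run_restore hv, treat, Function.update_apply, h.done_of_last hl]
  have hmem : S.last w ∈ (List.finRange (n + 1)).map (finSuccEquiv n) :=
    List.mem_map.2 ⟨(finSuccEquiv n).symm (S.last w), List.mem_finRange _, by simp⟩
  have hcircuit : (S.treat G v).circuit = (S.circuit ++ load (S.last v) v) ++
      exchange S.last v (S.guests G v) ((List.finRange (n + 1)).map (finSuccEquiv n)) := rfl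
  rw [hcircuit, run_append _ (exchange _ _ _ _),
    run_exchange hI nodup_guests (by simp [mem_guests]) hlast]
  simp only [hmem, and_true, mem_guests, hload, h.run_restore hv]
  by_cases hg : G.Adj v w ∧ S.done w = false
  · have hcancel (a b c : ZMod 2) : a + b + (c + a) = c + b := by
      rw [← add_assoc, add_right_comm, add_right_comm a, CharTwo.add_self_eq_zero, zero_add,
        add_comm]
    simp [treat, hg, hg.1.ne', hcancel]
  · by_cases hwv : w = v
    · simp [treat, hwv]
    · by_cases hd : S.done w <;> simp_all [treat]

lemma Valid.done_treat_iff (hpos : pos.Injective) (u : Fin n) :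
    (S.treat G v).done u = true ↔ pos u < k + 1 := by
  by_cases huv : u = v
  · simp [treat, huv, hv]
  · have : pos u ≠ k := fun hu => huv (hpos (hu.trans hv.symm))
    simp only [treat, Function.update_of_ne huv, h.done_iff]
    omega

lemma Valid.last_treat_spec (hpos : pos.Injective) (w i : Fin n)
    (hi : (S.treat G v).last w = some i) : IsLast G pos w (k + 1) i := by
  by_cases hadj : G.Adj v w
  · obtain rfl : v = i := by simpa [treat, hadj] using hi
    exact ⟨hadj.symm, by omega, fun u _ hu => by omega⟩
  · obtain ⟨hwi, hik, hmax⟩ := h.last_spec w i (by simpa [treat, hadj] using hi)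
    refine ⟨hwi, by omega, fun u hu huk => hmax u hu ?_⟩
    have huv : u ≠ v := fun huv => hadj (huv ▸ hu.symm)
    have : pos u ≠ k := fun h' => huv (hpos (h'.trans hv.symm))
    omega

lemma Valid.term_treat (hpos : pos.Injective) (u w : Fin n) (huw : G.Adj u w)
    (hu : pos u < k + 1) : (S.treat G v).circuit.HasTerm {u, w} := by
  have hold : ∀ a b, G.Adj a b → pos a < k → (S.treat G v).circuit.HasTerm {a, b} :=
    fun a b hab ha => ((h.term a b hab ha).append _).append _
  by_cases huk : pos u < k
  · exact hold u w huw huk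
  obtain rfl : u = v := hpos (by omega)
  by_cases hwk : pos w < k
  · exact Finset.pair_comm u w ▸ hold w u huw.symm hwk
  have hwd : (S.treat G u).done w = false := by
    rw [← Bool.not_eq_true, h.done_treat_iff hv hpos]
    have : pos w ≠ pos u := fun h' => huw.ne' (hpos h')
    omega
  refine ⟨_, List.prefix_refl _, w, fun x => ?_⟩
  rw [h.run_treat hv, hwd, Finset.sum_pair huw.ne, add_comm]
  simp [treat, huw]

lemma Valid.length_treat_le (hpos : pos.Injective) :
    (S.treat G v).circuit.length ≤ S.circuit.length + cost G pos v := by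
  have hguests : (S.guests G v).length ≤ #{w | G.Adj v w ∧ pos v < pos w} := by
    rw [← List.toFinset_card_of_nodup nodup_guests]
    refine Finset.card_le_card fun w hw => ?_
    rw [List.mem_toFinset] at hw
    obtain ⟨hadj, hd⟩ := mem_guests.1 hw
    rw [← Bool.not_eq_true, h.done_iff] at hd
    have : pos v ≠ pos w := fun h' => hadj.ne (hpos h')
    exact (Finset.mem_filter_univ _).2 ⟨hadj, by omega⟩
  have hlinks : #((S.guests G v).filterMap S.last).toFinset ≤ #(links G pos v) := by
    refine Finset.card_le_card fun i hi => ?_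
    simp only [List.mem_toFinset, List.mem_filterMap] at hi
    obtain ⟨w, hw, hi⟩ := hi
    exact mem_links.2 ⟨w, (mem_guests.1 hw).1.symm, hv ▸ h.last_spec w i hi⟩
  have hload : (load (S.last v) v).length ≤ 1 :=
    (length_load_le _ _).trans (by split <;> simp)
  have hexchange := length_exchange_le S.last v
    ((List.nodup_finRange (n + 1)).map (finSuccEquiv n).injective)
    (nodup_guests (G := G) (S := S) (v := v))
  simp only [treat, cost, List.length_append]
  omega

lemma Valid.treat (hpos : pos.Injective) : Valid G pos (k + 1) (S.treat G v) where
  done_iff := h.done_treat_iff hv hpos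
  last_spec := h.last_treat_spec hv hpos
  run := h.run_treat hv
  term := h.term_treat hv hpos
  length := by
    have hinsert : Finset.univ.filter (pos · < k + 1) =
        insert v (Finset.univ.filter (pos · < k)) := by
      ext u
      have : u = v ↔ pos u = k := by rw [← hv, hpos.eq_iff]
      simp only [Finset.mem_filter_univ, Finset.mem_insert]
      omega
    rw [hinsert, Finset.sum_insert (by simp [hv]), add_comm]
    exact (h.length_treat_le hv hpos).trans (by gcongr; exact h.length)

end

lemma Valid.foldl_treat (hpos : pos.Injective) (l : List (Fin n)) (h : Valid G pos k S)
    (hl : ∀ j (hj : j < l.length), pos l[j] = k + j) :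
    Valid G pos (k + l.length) (l.foldl (Sweep.treat G) S) := by
  induction l generalizing k S with
  | nil => exact h
  | cons a l ih =>
    rw [List.length_cons, ← Nat.succ_add_eq_add_succ]
    refine ih (h.treat (hl 0 (by simp)) hpos) fun j hj => ?_
    have := hl (j + 1) (by simpa using hj)
    simp only [List.getElem_cons_succ] at this
    omega

end

section

variable {n N : ℕ}

/-- The vertices sorted by label, then by index. -/
def order (label : Fin n → Fin N) : List (Fin n) :=
  (List.finRange N).flatMap fun b => (List.finRange n).filter (label · = b)

/-- The position of a vertex in the order given by the labels. -/
def position (label : Fin n → Fin N) (v : Fin n) : ℕ := (order label).idxOf v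

variable (label : Fin n → Fin N)

lemma mem_order (v : Fin n) : v ∈ order label := by
  simp [order]

lemma nodup_order : (order label).Nodup := by
  refine List.nodup_flatMap.2 ⟨fun b _ => (List.nodup_finRange n).filter _, ?_⟩
  refine (List.nodup_iff_pairwise_ne.1 (List.nodup_finRange N)).imp fun {a b} hab => ?_
  refine List.disjoint_left.2 fun v hva hvb => hab ?_
  simp only [List.mem_filter, List.mem_finRange, true_and, decide_eq_true_eq] at hva hvb
  exact hva.symm.trans hvb

lemma pairwise_order : (order label).Pairwise fun u v => label u ≤ label v := by
  refine List.pairwise_flatMap.2 ⟨fun b _ => ?_, ?_⟩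
  · refine List.pairwise_of_forall_mem_list fun u hu v hv => ?_
    simp only [List.mem_filter, List.mem_finRange, true_and, decide_eq_true_eq] at hu hv
    exact (hu.trans hv.symm).le
  · refine (List.pairwise_lt_finRange _).imp fun {a b} hab u hu v hv => ?_
    simp only [List.mem_filter, List.mem_finRange, true_and, decide_eq_true_eq] at hu hv
    exact hu ▸ hv ▸ hab.le

lemma length_order : (order label).length = n := by
  rw [← List.toFinset_card_of_nodup (nodup_order label),
    Finset.eq_univ_of_forall fun v => List.mem_toFinset.2 (mem_order label v), Finset.card_fin]

lemma position_lt (v : Fin n) : position label v < n :=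
  (List.idxOf_lt_length_iff.2 (mem_order label v)).trans_eq (length_order label)

lemma position_injective : (position label).Injective := fun u _ h =>
  (List.idxOf_inj (mem_order label u)).1 h

lemma label_le_of_position_le {u v : Fin n} (h : position label u ≤ position label v) :
    label u ≤ label v := by
  rcases h.lt_or_eq with h | h
  · simpa using List.pairwise_iff_getElem.1 (pairwise_order label) _ _
      (List.idxOf_lt_length_iff.2 (mem_order label u))
      (List.idxOf_lt_length_iff.2 (mem_order label v)) h
  · rw [position_injective label h]

end

section

variable {n N : ℕ} (G : SimpleGraph (Fin n)) [DecidableRel G.Adj] (label : Fin n → Fin N)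

/-- The circuit built by a complete sweep in the order given by the labels. -/
def network : CNOTCircuit (Fin n) :=
  ((order label).foldl (treat G) (start n)).circuit

lemma valid_foldl_order :
    Valid G (position label) n ((order label).foldl (treat G) (start n)) := by
  have := (valid_start G (position label)).foldl_treat (position_injective label) (order label)
    fun j hj => (nodup_order label).idxOf_getElem j hj |>.trans (zero_add j).symm
  rwa [length_order, zero_add] at this

theorem isGraphicParityNetwork_network : (network G label).IsGraphicParityNetwork G := by
  have h := valid_foldl_order G label
  constructor
  · rintro A ⟨u, v, huv, rfl⟩
    exact h.term u v huv (position_lt label u)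
  · intro x
    funext w
    simpa [network, (h.done_iff w).2 (position_lt label w)] using h.run x w

theorem length_network_le : (network G label).length ≤
    #G.edgeFinset + n + 2 * ∑ v, #(links G (position label) v) := by
  refine (valid_foldl_order G label).length.trans ?_
  rw [Finset.filter_true_of_mem fun v _ => position_lt label v]
  simp only [cost, Finset.sum_add_distrib, ← Finset.mul_sum, Finset.sum_const, Finset.card_univ,
    Fintype.card_fin, smul_eq_mul, mul_one]
  gcongr
  exact sum_card_later_neighbors_le G (position label)

end

end Sweep

section

open scoped Finset

variable {ι Λ : Type*} [Fintype ι] [DecidableEq ι] [Fintype Λ]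

lemma expect_update (v : ι) (F : (ι → Λ) → ℝ) :
    𝔼 f : ι → Λ, 𝔼 a, F (Function.update f v a) = 𝔼 f, F f := by
  rcases isEmpty_or_nonempty Λ with hΛ | hΛ
  · have : IsEmpty (ι → Λ) := ⟨fun f => hΛ.elim (f v)⟩
    simp
  let resample : (ι → Λ) × Λ → (ι → Λ) × Λ := fun p => (Function.update p.1 v p.2, p.1 v)
  have hinv : resample.Involutive := fun p => by simp [resample]
  calc 𝔼 f : ι → Λ, 𝔼 a, F (Function.update f v a)
      = 𝔼 p : (ι → Λ) × Λ, F (resample p).1 := by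
        rw [← Finset.univ_product_univ, Finset.expect_product]
    _ = 𝔼 p : (ι → Λ) × Λ, F p.1 :=
        Fintype.expect_equiv (hinv.toPerm resample) _ _ fun _ => rfl
    _ = 𝔼 f, F f := by
        rw [← Finset.univ_product_univ, Finset.expect_product]
        simp

lemma expect_boole_le_of_update (P : (ι → Λ) → Prop) [DecidablePred P] (v : ι) {c : ℕ}
    (hc : ∀ f : ι → Λ, #{a | P (Function.update f v a)} ≤ c) :
    𝔼 f, (if P f then (1 : ℝ) else 0) ≤ c / Fintype.card Λ := by
  rw [← expect_update v]
  have hle : ∀ f : ι → Λ, 𝔼 a, (if P (Function.update f v a) then (1 : ℝ) else 0) ≤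
      c / Fintype.card Λ := fun f => by
    rw [Fintype.expect_eq_sum_div_card, Finset.sum_boole]
    gcongr
    exact hc f
  rcases isEmpty_or_nonempty (ι → Λ) with h | h
  · simp only [Finset.univ_eq_empty, Finset.expect_empty]
    positivity
  · exact Finset.expect_le Finset.univ_nonempty fun f _ => hle f

lemma expect_boole_forall_notMem [DecidableEq Λ] [Nonempty Λ] (N : Finset ι) (A : Finset Λ) :
    𝔼 f : ι → Λ, (if ∀ u ∈ N, f u ∉ A then (1 : ℝ) else 0) =
      (1 - #A / Fintype.card Λ) ^ #N := by
  have hpi : ({f : ι → Λ | ∀ u ∈ N, f u ∉ A} : Finset (ι → Λ)) =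
      Fintype.piFinset fun u => if u ∈ N then Aᶜ else Finset.univ := by
    ext f
    simp only [Finset.mem_filter_univ, Fintype.mem_piFinset]
    refine forall_congr' fun u => ?_
    by_cases hu : u ∈ N <;> simp [hu]
  have hΛ : (Fintype.card Λ : ℝ) ≠ 0 := by positivity
  calc 𝔼 f : ι → Λ, (if ∀ u ∈ N, f u ∉ A then (1 : ℝ) else 0)
      = ∏ u, (#(if u ∈ N then Aᶜ else Finset.univ) : ℝ) / Fintype.card Λ := by
        rw [Fintype.expect_eq_sum_div_card, Finset.sum_boole, hpi, Fintype.card_piFinset,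
          Finset.prod_div_distrib]
        simp
    _ = ∏ u, if u ∈ N then (1 - #A / Fintype.card Λ : ℝ) else 1 := by
        refine Finset.prod_congr rfl fun u _ => ?_
        split_ifs
        · rw [Finset.card_compl, Nat.cast_sub (Finset.card_le_univ A), sub_div, div_self hΛ]
        · rw [Finset.card_univ, div_self hΛ]
    _ = (1 - #A / Fintype.card Λ) ^ #N := by
        rw [Fintype.prod_ite_mem, Finset.prod_const]

lemma expect_comp_injective {α β γ : Type*} [Fintype α] [DecidableEq α] [Fintype β]
    [DecidableEq β] [Fintype γ] [Nonempty γ] {e : α → β} (he : e.Injective)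
    (F : (α → γ) → ℝ) : 𝔼 ω : β → γ, F (ω ∘ e) = 𝔼 τ, F τ := by
  classical
  let split : (β → γ) ≃ (α → γ) × ({b // b ∉ Set.range e} → γ) :=
    (Equiv.piEquivPiSubtypeProd (· ∈ Set.range e) fun _ => γ).trans
      (((Equiv.ofInjective e he).symm.arrowCongr (Equiv.refl γ)).prodCongr (Equiv.refl _))
  calc 𝔼 ω : β → γ, F (ω ∘ e) = 𝔼 p : (α → γ) × ({b // b ∉ Set.range e} → γ), F p.1 :=
        Fintype.expect_equiv split _ _ fun ω => by
          congr 1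
    _ = 𝔼 τ, F τ := by
        rw [← Finset.univ_product_univ, Finset.expect_product]
        simp

end

namespace Sweep

open scoped Finset

lemma card_filter_div_eq {B s b : ℕ} (hs : 0 < s) (hb : b < B / s) :
    #{x : Fin B | (x : ℕ) / s = b} = s := by
  have hB : (b + 1) * s ≤ B := (Nat.mul_le_mul_right s hb).trans (Nat.div_mul_le_self B s)
  have himage : ({x : Fin B | (x : ℕ) / s = b} : Finset (Fin B)).map Fin.valEmbedding =
      Finset.Ico (b * s) ((b + 1) * s) := by
    ext x
    have hiff : x / s = b ↔ b * s ≤ x ∧ x < (b + 1) * s := by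
      rw [Nat.div_eq_iff hs]
      grind
    simp only [Finset.mem_map, Finset.mem_filter_univ, Fin.valEmbedding_apply, Finset.mem_Ico,
      ← hiff]
    refine ⟨fun ⟨_, hy, hyx⟩ => hyx ▸ hy, fun hx => ⟨⟨x, ?_⟩, hx, rfl⟩⟩
    exact (hiff.1 hx).2.trans_le hB
  rw [← Finset.card_map, himage, Nat.card_Ico, ← Nat.sub_mul]
  simp

section

variable {V : Type*} [Fintype V] [DecidableEq V] {B s : ℕ} [NeZero B]

lemma expect_sum_card_near_le (hs : 0 < s) :
    𝔼 f : V → Fin B, ∑ v, (#(near (fun u => (f u : ℕ)) s v) : ℝ) ≤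
      Fintype.card V + Fintype.card V ^ 2 * (2 * s / B) := by
  let P (i v : V) (f : V → Fin B) : Prop := (f i : ℕ) ≤ f v ∧ (f v : ℕ) / s ≤ f i / s + 1
  have hpair : ∀ v i, 𝔼 f : V → Fin B, (if P i v f then (1 : ℝ) else 0) ≤
      (if v = i then 1 else 0) + 2 * s / B := by
    intro v i
    split_ifs with h
    · have hone : 𝔼 f : V → Fin B, (if P i v f then (1 : ℝ) else 0) ≤ 1 :=
        Finset.expect_le Finset.univ_nonempty fun f _ => by split_ifs <;> norm_num
      exact hone.trans (le_add_of_nonneg_right (by positivity))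
    · have hcount : ∀ f : V → Fin B, #{a | P i v (Function.update f i a)} ≤ 2 * s := fun f => by
        simpa [P, h, -Fin.val_fin_le] using card_filter_near_le Fin.val_injective hs (f v : ℕ)
      simpa using expect_boole_le_of_update (P i v) i hcount
  calc 𝔼 f : V → Fin B, ∑ v, (#(near (fun u => (f u : ℕ)) s v) : ℝ)
      = ∑ v, ∑ i, 𝔼 f : V → Fin B, if P i v f then (1 : ℝ) else 0 := by
        simp only [near, ← Finset.sum_boole, Finset.expect_sum_comm, P]
    _ ≤ ∑ v : V, ∑ i : V, ((if v = i then 1 else 0) + 2 * s / B : ℝ) :=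
        Finset.sum_le_sum fun v _ => Finset.sum_le_sum fun i _ => hpair v i
    _ = Fintype.card V + Fintype.card V ^ 2 * (2 * s / B) := by
        simp only [Finset.sum_add_distrib, Finset.sum_ite_eq, Finset.mem_univ, if_true,
          Finset.sum_const, Finset.card_univ, nsmul_eq_mul]
        ring

lemma expect_boole_gap_le (hs : 0 < s) (N : Finset V) :
    𝔼 f : V → Fin B, (if ∃ b < B / s, ∀ u ∈ N, (f u : ℕ) / s ≠ b then (1 : ℝ) else 0) ≤
      B * Real.exp (-(s / B * #N)) := by
  have hmiss : ∀ b < B / s, 𝔼 f : V → Fin B,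
      (if ∀ u ∈ N, (f u : ℕ) / s ≠ b then (1 : ℝ) else 0) ≤ Real.exp (-(s / B * #N)) := by
    intro b hb
    have hsB : s ≤ B := Nat.one_le_div_iff hs |>.1 (by omega)
    have havoid := expect_boole_forall_notMem N ({x : Fin B | (x : ℕ) / s = b} : Finset (Fin B))
    simp only [Finset.mem_filter_univ, card_filter_div_eq hs hb, Fintype.card_fin] at havoid
    calc _ = (1 - s / B : ℝ) ^ #N := havoid
      _ ≤ Real.exp (-(s / B)) ^ #N := by
        gcongr
        · rw [sub_nonneg]
          exact div_le_one_of_le₀ (mod_cast hsB) (by positivity)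
        · exact Real.one_sub_le_exp_neg _
      _ = Real.exp (-(s / B * #N)) := by rw [← Real.exp_nat_mul]; ring_nf
  calc 𝔼 f : V → Fin B, (if ∃ b < B / s, ∀ u ∈ N, (f u : ℕ) / s ≠ b then (1 : ℝ) else 0)
      ≤ 𝔼 f : V → Fin B, ∑ b ∈ Finset.range (B / s),
          if ∀ u ∈ N, (f u : ℕ) / s ≠ b then (1 : ℝ) else 0 := by
        refine Finset.expect_le_expect fun f _ => ?_
        split_ifs with h
        · obtain ⟨_, hb, hN⟩ := h
          have := Finset.single_le_sum (f := fun b => if ∀ u ∈ N, (f u : ℕ) / s ≠ b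
            then (1 : ℝ) else 0) (fun _ _ => by split_ifs <;> norm_num) (Finset.mem_range.2 hb)
          rwa [if_pos hN] at this
        · exact Finset.sum_nonneg fun _ _ => by split_ifs <;> norm_num
    _ ≤ ∑ _b ∈ Finset.range (B / s), Real.exp (-(s / B * #N)) := by
        rw [Finset.expect_sum_comm]
        exact Finset.sum_le_sum fun _ hb => hmiss _ (Finset.mem_range.1 hb)
    _ ≤ B * Real.exp (-(s / B * #N)) := by
        rw [Finset.sum_const, Finset.card_range, nsmul_eq_mul]
        gcongr
        exact Nat.div_le_self B s

variable (G : SimpleGraph V) [DecidableRel G.Adj] {pos : (V → Fin B) → V → ℕ}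
  (hr : ∀ f u v, pos f u ≤ pos f v → f u ≤ f v)

include hr

lemma expect_card_jumps_le (hs : 0 < s) (w : V) :
    𝔼 f : V → Fin B, (#(jumps G (pos f) (fun u => f u) s w) : ℝ) ≤
      Fintype.card V * (B * Real.exp (-(s / B * G.degree w))) := by
  calc 𝔼 f : V → Fin B, (#(jumps G (pos f) (fun u => f u) s w) : ℝ)
      ≤ 𝔼 f : V → Fin B, Fintype.card V *
          if ∃ b < B / s, ∀ u ∈ G.neighborFinset w, (f u : ℕ) / s ≠ b then (1 : ℝ) else 0 := by
        refine Finset.expect_le_expect fun f _ => ?_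
        split_ifs with h
        · rw [mul_one]
          exact_mod_cast Finset.card_le_univ _
        · push Not at h
          rw [jumps_eq_empty (hr f) (fun u => (f u).is_lt) (by simpa using h)]
          simp
    _ ≤ Fintype.card V * (B * Real.exp (-(s / B * G.degree w))) := by
        rw [← Finset.mul_expect, ← G.card_neighborFinset_eq_degree]
        gcongr
        exact expect_boole_gap_le hs _

lemma sum_expect_card_jumps_le (hs : 0 < s) {c₁ : ℕ} {d : ℝ}
    (hd : #{v | (G.degree v : ℝ) < d} ≤ c₁) :
    ∑ w, 𝔼 f : V → Fin B, (#(jumps G (pos f) (fun u => f u) s w) : ℝ) ≤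
      c₁ * Fintype.card V + Fintype.card V ^ 2 * (B * Real.exp (-(s / B * d))) := by
  set n := Fintype.card V with hn
  have hjumps : ∀ w, 𝔼 f : V → Fin B, (#(jumps G (pos f) (fun u => f u) s w) : ℝ) ≤
      (if (G.degree w : ℝ) < d then (n : ℝ) else 0) + n * (B * Real.exp (-(s / B * d))) := by
    intro w
    split_ifs with hw
    · refine le_add_of_le_of_nonneg (Finset.expect_le Finset.univ_nonempty fun f _ => ?_)
        (by positivity)
      exact_mod_cast Finset.card_le_univ _
    · rw [zero_add]
      refine (expect_card_jumps_le G hr hs w).trans ?_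
      gcongr
      exact not_lt.1 hw
  calc ∑ w, 𝔼 f : V → Fin B, (#(jumps G (pos f) (fun u => f u) s w) : ℝ)
      ≤ ∑ w : V, ((if (G.degree w : ℝ) < d then (n : ℝ) else 0) +
          n * (B * Real.exp (-(s / B * d)))) := Finset.sum_le_sum fun w _ => hjumps w
    _ = #{v | (G.degree v : ℝ) < d} * n + n ^ 2 * (B * Real.exp (-(s / B * d))) := by
        rw [Finset.sum_add_distrib, ← Finset.sum_filter]
        simp only [Finset.sum_const, Finset.card_univ, nsmul_eq_mul, ← hn]
        ring
    _ ≤ _ := by gcongr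

lemma expect_sum_card_links_le (hpos : ∀ f, (pos f).Injective) (hs : 0 < s) {c₁ : ℕ} {d : ℝ}
    (hd : #{v | (G.degree v : ℝ) < d} ≤ c₁) :
    𝔼 f : V → Fin B, ∑ v, (#(links G (pos f) v) : ℝ) ≤
      Fintype.card V + Fintype.card V ^ 2 * (2 * s / B) + (c₁ * Fintype.card V +
        Fintype.card V ^ 2 * (B * Real.exp (-(s / B * d)))) := by
  calc 𝔼 f : V → Fin B, ∑ v, (#(links G (pos f) v) : ℝ)
      ≤ 𝔼 f : V → Fin B, (∑ v, (#(near (fun u => (f u : ℕ)) s v) : ℝ) +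
          ∑ w, (#(jumps G (pos f) (fun u => f u) s w) : ℝ)) :=
        Finset.expect_le_expect fun f _ => mod_cast sum_card_links_le (hr f) (hpos f) s
    _ = 𝔼 f : V → Fin B, ∑ v, (#(near (fun u => (f u : ℕ)) s v) : ℝ) +
          ∑ w, 𝔼 f : V → Fin B, (#(jumps G (pos f) (fun u => f u) s w) : ℝ) := by
        rw [Finset.expect_add_distrib,
          Finset.expect_sum_comm _ _ fun f w => (#(jumps G (pos f) (fun u => f u) s w) : ℝ)]
    _ ≤ _ := add_le_add (expect_sum_card_near_le hs) (sum_expect_card_jumps_le G hr hs hd)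

end

end Sweep

namespace Sweep

open scoped Finset

section

variable {n L R : ℕ}

/-- The bijection that reads `L` bits at each of `n` vertices as a label below `2 ^ L`, the least
significant bit first. -/
def labelEquiv (n L : ℕ) : (Fin n × Fin L → Bool) ≃ (Fin n → Fin (2 ^ L)) :=
  (Equiv.curry (Fin n) (Fin L) Bool).trans <| Equiv.piCongrRight fun _ =>
    (Equiv.piCongrRight fun _ => finTwoEquiv.symm).trans finFunctionFinEquiv

/-- The labels that the coins `ω` give to the vertices: the coins `v * L, …, v * L + L - 1` are the
bits of the label of `v`. -/
def coinLabel (hR : n * L ≤ R) (ω : Fin R → Bool) : Fin n → Fin (2 ^ L) :=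
  labelEquiv n L (ω ∘ Fin.castLE hR ∘ finProdFinEquiv)

lemma coinLabel_val (hR : n * L ≤ R) (ω : Fin R → Bool) (v : Fin n) :
    (coinLabel hR ω v : ℕ) =
      ∑ j : Fin L, (ω (Fin.castLE hR (finProdFinEquiv (v, j)))).toNat * 2 ^ (j : ℕ) := by
  simp only [coinLabel, labelEquiv, Equiv.trans_apply, Equiv.piCongrRight_apply, Pi.map_apply,
    finFunctionFinEquiv_apply_val]
  refine Finset.sum_congr rfl fun j _ => ?_
  congr 1
  simp only [Equiv.curry_apply, Function.curry, Function.comp_apply]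
  cases ω (Fin.castLE hR (finProdFinEquiv (v, j))) <;> rfl

lemma expect_coinLabel (hR : n * L ≤ R) (F : (Fin n → Fin (2 ^ L)) → ℝ) :
    𝔼 ω, F (coinLabel hR ω) = 𝔼 f, F f :=
  calc 𝔼 ω, F (coinLabel hR ω) = 𝔼 τ, F (labelEquiv n L τ) :=
        expect_comp_injective ((Fin.castLE_injective hR).comp finProdFinEquiv.injective)
          fun τ => F (labelEquiv n L τ)
    _ = 𝔼 f, F f := Fintype.expect_equiv (labelEquiv n L) _ _ fun _ => rfl

lemma half_le_log (hn : 1 < n) : (1 / 2 : ℝ) ≤ Real.log n := by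
  have hlog : Real.log 2 ≤ Real.log n := Real.log_le_log two_pos (mod_cast hn)
  linarith [Real.log_two_gt_d9]

lemma two_pow_clog_le (hn : 0 < n) : 2 ^ Nat.clog 2 n ≤ n + n := by
  rcases h : Nat.clog 2 n with _ | k
  · rw [pow_zero]
    omega
  · have := Nat.pow_lt_of_lt_clog (b := 2) (x := n) (y := k) (by omega)
    omega

end

section

variable {n : ℕ} (G : SimpleGraph (Fin n)) [DecidableRel G.Adj]

theorem length_network_le_rpow {N : ℕ} (label : Fin n → Fin N) :
    ((network G label).length : ℝ) ≤ #G.edgeFinset + 13 * (n : ℝ) ^ (3 / 2 : ℝ) := by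
  have hlength : ((network G label).length : ℝ) ≤ #G.edgeFinset + n + 12 * (n * n.sqrt) := by
    have hnet := length_network_le G label
    have hlinks := sum_card_links_le_sqrt G (position_injective label) (fun v => by
      simpa using position_lt label v)
    rw [Fintype.card_fin] at hlinks
    exact_mod_cast hnet.trans (by linarith)
  have hrpow : (n : ℝ) ^ (3 / 2 : ℝ) = n * √n := by
    rw [Real.sqrt_eq_rpow, ← Real.rpow_one_add' n.cast_nonneg (by norm_num)]
    norm_num
  have hsqrt : (n : ℝ) * n.sqrt ≤ n * √n := by
    gcongr
    exact Real.nat_sqrt_le_real_sqrt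
  have hle : (n : ℝ) ≤ n * √n := by
    rcases n.eq_zero_or_pos with rfl | hn
    · simp
    · exact le_mul_of_one_le_right n.cast_nonneg (Real.one_le_sqrt.2 (mod_cast hn))
  rw [hrpow]
  linarith

/-- With blocks of length `s = ⌈4 log n / c₂⌉`, a vertex of degree at least `c₂ * n` misses some
block with probability `O(1 / n)` only. -/
lemma expect_sum_card_links_le_log {B c₁ : ℕ} [NeZero B] {c₂ : ℝ} (hn : 1 < n) (hnB : n ≤ B)
    (hB : B ≤ n + n) (hc₂ : 0 < c₂) (hdeg : #{v | (G.degree v : ℝ) < c₂ * n} ≤ c₁) :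
    𝔼 f : Fin n → Fin B, ∑ v, (#(links G (position f) v) : ℝ) ≤
      (10 + 2 * c₁ + 8 / c₂) * (n * Real.log n) := by
  have hn0 : (0 : ℝ) < n := by positivity
  have hB0 : (0 : ℝ) < B := mod_cast NeZero.pos B
  have hnB' : (n : ℝ) ≤ B := mod_cast hnB
  have hB' : (B : ℝ) ≤ 2 * n := by exact_mod_cast hB.trans_eq (two_mul n).symm
  have hlog := half_le_log hn
  set s : ℕ := ⌈4 * Real.log n / c₂⌉₊
  have hs0 : 0 < s := Nat.ceil_pos.2 (by positivity)
  have hs_ge : 4 * Real.log n / c₂ ≤ s := Nat.le_ceil _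
  have hs_le : (s : ℝ) ≤ 4 * Real.log n / c₂ + 1 := (Nat.ceil_lt_add_one (by positivity)).le
  have hnear : (n : ℝ) ^ 2 * (2 * s / B) ≤ 8 / c₂ * (n * Real.log n) + 2 * n :=
    calc (n : ℝ) ^ 2 * (2 * s / B) = 2 * n * s * (n / B) := by ring
      _ ≤ 2 * n * (4 * Real.log n / c₂ + 1) * 1 := by
        gcongr
        exact (div_le_one hB0).2 hnB'
      _ = 8 / c₂ * (n * Real.log n) + 2 * n := by ring
  have hexp : Real.exp (-(s / B * (c₂ * n))) ≤ ((n : ℝ) ^ 2)⁻¹ := by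
    rw [← Real.exp_log (pow_pos hn0 2), ← Real.exp_neg, Real.exp_le_exp, Real.log_pow,
      neg_le_neg_iff]
    calc (2 : ℕ) * Real.log n = 4 * Real.log n / c₂ / (2 * n) * (c₂ * n) := by
          push_cast
          field_simp
          ring
      _ ≤ s / B * (c₂ * n) := by gcongr
  have hgaps : (n : ℝ) ^ 2 * (B * Real.exp (-(s / B * (c₂ * n)))) ≤ 2 * (n : ℝ) :=
    calc (n : ℝ) ^ 2 * (B * Real.exp (-(s / B * (c₂ * n)))) ≤
          n ^ 2 * (2 * n * ((n : ℝ) ^ 2)⁻¹) := by gcongr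
      _ = 2 * (n : ℝ) := by field_simp
  have hmain := expect_sum_card_links_le G (pos := fun f : Fin n → Fin B => position f)
    (fun f _ _ h => label_le_of_position_le f h) position_injective hs0 hdeg
  rw [Fintype.card_fin] at hmain
  have hn_le : (n : ℝ) ≤ 2 * (n * Real.log n) := by nlinarith
  have hc₁ : (c₁ : ℝ) * n ≤ c₁ * (2 * (n * Real.log n)) := by gcongr
  linarith

theorem expectedSize_network_coinLabel_le {R c₁ : ℕ} {c₂ : ℝ} (hR : n * Nat.clog 2 n ≤ R)
    (hc₂ : 0 < c₂) (hdeg : #{v | (G.degree v : ℝ) < c₂ * n} ≤ c₁) :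
    expectedSize (fun ω => network G (coinLabel hR ω)) ≤
      #G.edgeFinset + (22 + 4 * c₁ + 16 / c₂) * (n * Real.log n) := by
  rcases Nat.lt_or_ge 1 n with hn | hn
  · calc expectedSize (fun ω => network G (coinLabel hR ω))
        ≤ 𝔼 ω, (#G.edgeFinset + n + 2 * ∑ v, (#(links G (position (coinLabel hR ω)) v) : ℝ)) :=
          Finset.expect_le_expect fun ω _ => mod_cast length_network_le G (coinLabel hR ω)
      _ = #G.edgeFinset + n + 2 * 𝔼 f, ∑ v, (#(links G (position f) v) : ℝ) := by
          rw [Finset.expect_add_distrib, Finset.expect_const Finset.univ_nonempty,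
            ← Finset.mul_expect,
            expect_coinLabel hR fun f => ∑ v, (#(links G (position f) v) : ℝ)]
      _ ≤ #G.edgeFinset + n + 2 * ((10 + 2 * c₁ + 8 / c₂) * (n * Real.log n)) := by
          gcongr
          exact expect_sum_card_links_le_log G hn (Nat.le_pow_clog one_lt_two n)
            (two_pow_clog_le hn.le) hc₂ hdeg
      _ ≤ #G.edgeFinset + (22 + 4 * c₁ + 16 / c₂) * (n * Real.log n) := by
          have hn_le : (n : ℝ) ≤ 2 * (n * Real.log n) := by nlinarith [half_le_log hn]
          linarith [show 2 * (8 / c₂ * (n * Real.log n)) = 16 / c₂ * (n * Real.log n) by ring]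
  · have : Subsingleton (Fin n) := Fin.subsingleton_iff_le_one.2 hn
    have := Real.log_natCast_nonneg n
    simp only [expectedSize, CNOTCircuit.length_eq_zero, Nat.cast_zero, Finset.expect_const_zero]
    positivity

end

end Sweep

namespace RAMState

/-- The state after an assignment to the register `r`. -/
def setReg (s : RAMState) (r x : ℕ) : RAMState := { s with reg := Function.update s.reg r x }

/-- The state after an assignment to the entry `i` of the array `a`. -/
def setArr (s : RAMState) (a i x : ℕ) : RAMState :=
  { s with arr := Function.update s.arr a (Function.update (s.arr a) i x) }

/-- The state after a number was written to the output. -/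
def emit (s : RAMState) (x : ℕ) : RAMState := { s with out := s.out ++ [x] }

/-- The state after the coin tosses were replaced by `l`. -/
def setCoins (s : RAMState) (l : List Bool) : RAMState := { s with coins := l }

section

variable (s : RAMState) (r x a i k : ℕ) (l : List Bool)

@[simp] lemma reg_setReg : (s.setReg r x).reg k = if k = r then x else s.reg k :=
  Function.update_apply ..

@[simp] lemma arr_setArr (b j : ℕ) :
    (s.setArr a i x).arr b j = if b = a ∧ j = i then x else s.arr b j := by
  by_cases h : b = a
  · subst h
    simp [setArr, Function.update_apply]
  · simp [setArr, h]

@[simp] lemma reg_emit : (s.emit x).reg = s.reg := rfl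

@[simp] lemma arr_emit : (s.emit x).arr = s.arr := rfl

@[simp] lemma out_emit : (s.emit x).out = s.out ++ [x] := rfl

@[simp] lemma reg_setCoins : (s.setCoins l).reg = s.reg := rfl

end

end RAMState

namespace RAMProgram

/-- Started in `s`, the program `p` halts within `t` steps in a state with the property `Q`. -/
def Ends (p : RAMProgram) (t : ℕ) (s : RAMState) (Q : RAMState → Prop) : Prop :=
  ∃ t' ≤ t, ∃ s', p.Exec s t' s' ∧ Q s'

/-- `p` if `e = f`, else `q`. -/
def ifEq (e f : RAMExpr) (p q : RAMProgram) : RAMProgram := .ifLt e f q (.ifLt f e q p)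

/-- Run `p` for the values `0, …, e - 1` of the register `r`. -/
def forLoop (r : ℕ) (e : RAMExpr) (p : RAMProgram) : RAMProgram :=
  .seq (.assign r (.const 0))
    (.whileLt (.reg r) e (.seq p (.assign r (.add (.reg r) (.const 1)))))

namespace Ends

variable {p q : RAMProgram} {s : RAMState} {t t' : ℕ} {Q Q' : RAMState → Prop} {e f : RAMExpr}

lemma of_le (h : Ends p t s Q) (ht : t ≤ t') : Ends p t' s Q := by
  obtain ⟨u, hu, h⟩ := h
  exact ⟨u, hu.trans ht, h⟩

lemma imp (h : Ends p t s Q) (hQ : ∀ s, Q s → Q' s) : Ends p t s Q' := by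
  obtain ⟨u, hu, s', he, hq⟩ := h
  exact ⟨u, hu, s', he, hQ s' hq⟩

lemma seq (h : Ends p t s fun s' => Ends q t' s' Q) : Ends (.seq p q) (t + t') s Q := by
  obtain ⟨u, hu, s', he, u', hu', s'', he', hq⟩ := h
  exact ⟨u + u', add_le_add hu hu', s'', .seq he he', hq⟩

lemma assign {r : ℕ} (h : Q (s.setReg r (e.eval s))) : Ends (.assign r e) 1 s Q :=
  ⟨1, le_rfl, _, .assign r e s, h⟩

lemma store {a : ℕ} {i : RAMExpr} (h : Q (s.setArr a (i.eval s) (e.eval s))) :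
    Ends (.store a i e) 1 s Q :=
  ⟨1, le_rfl, _, .store a i e s, h⟩

lemma write (h : Q (s.emit (e.eval s))) : Ends (.write e) 1 s Q :=
  ⟨1, le_rfl, _, .write e s, h⟩

lemma skip (h : Q s) : Ends .skip 1 s Q :=
  ⟨1, le_rfl, _, .skip s, h⟩

lemma coin {r : ℕ} {b : Bool} {l : List Bool} (hs : s.coins = b :: l)
    (h : Q ((s.setReg r b.toNat).setCoins l)) : Ends (.coin r) 1 s Q :=
  ⟨1, le_rfl, _, .coin r b l s hs, h⟩

lemma ifLt (hp : e.eval s < f.eval s → Ends p t s Q) (hq : ¬ e.eval s < f.eval s → Ends q t s Q) :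
    Ends (.ifLt e f p q) (t + 1) s Q := by
  by_cases hc : e.eval s < f.eval s
  · obtain ⟨u, hu, s', he, hQ⟩ := hp hc
    exact ⟨u + 1, by omega, s', .if_true hc he, hQ⟩
  · obtain ⟨u, hu, s', he, hQ⟩ := hq hc
    exact ⟨u + 1, by omega, s', .if_false hc he, hQ⟩

lemma ifEq (hp : e.eval s = f.eval s → Ends p t s Q) (hq : e.eval s ≠ f.eval s → Ends q t s Q) :
    Ends (ifEq e f p q) (t + 2) s Q :=
  ifLt (t := t + 1) (fun h => (hq h.ne).of_le (Nat.le_succ t)) fun h =>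
    ifLt (fun h' => hq h'.ne') fun h' => hp (by omega)

lemma whileLt (I : ℕ → RAMState → Prop) (N : ℕ)
    (htest : ∀ k s, k ≤ N → I k s → (e.eval s < f.eval s ↔ k < N))
    (hbody : ∀ k s, k < N → I k s → Ends p t s (I (k + 1)))
    (h0 : I 0 s) : Ends (.whileLt e f p) (N * (t + 1) + 1) s (I N) := by
  suffices key : ∀ d k s, k + d = N → I k s →
      Ends (.whileLt e f p) (d * (t + 1) + 1) s (I N) from key N 0 s (zero_add N) h0
  intro d
  induction d with
  | zero =>
    rintro k s rfl hI
    exact ⟨1, by omega, s, .while_false fun h => lt_irrefl k ((htest k s le_rfl hI).1 h), hI⟩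
  | succ d ih =>
    intro k s hk hI
    obtain ⟨u, hu, s', he, hI'⟩ := hbody k s (by omega) hI
    obtain ⟨u', hu', s'', he', hI''⟩ := ih (k + 1) s' (by omega) hI'
    refine ⟨u + u' + 1, ?_, s'', .while_true ((htest k s (by omega) hI).2 (by omega)) he he', hI''⟩
    rw [add_mul]
    omega

lemma forLoop {r : ℕ} (I : ℕ → RAMState → Prop) (N : ℕ)
    (hI : ∀ k s x, I k s → I k (s.setReg r x)) (he : ∀ k s, I k s → e.eval s = N)
    (hbody : ∀ k s, k < N → I k s → s.reg r = k →
      Ends p t s fun s' => I (k + 1) s' ∧ s'.reg r = k)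
    (h0 : I 0 s) : Ends (forLoop r e p) (N * (t + 2) + 2) s (I N) := by
  refine of_le (seq (t := 1) (t' := N * (t + 1 + 1) + 1) (assign ?_)) (by ring_nf; rfl)
  refine imp (whileLt (fun k s => I k s ∧ s.reg r = k) N ?_ ?_ ?_) fun _ => And.left
  · rintro k s - ⟨hk, hr⟩
    simp [RAMExpr.eval, he k s hk, hr]
  · rintro k s hkN ⟨hk, hr⟩
    refine seq ((hbody k s hkN hk hr).imp fun s' ⟨hk', hr'⟩ => assign ?_)
    exact ⟨hI _ _ _ hk', by simp [RAMExpr.eval, hr']⟩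
  · exact ⟨hI _ _ _ h0, by simp [RAMExpr.eval]⟩

end Ends

end RAMProgram

lemma take_finRange_succ {n k : ℕ} (hk : k < n) :
    (List.finRange n).take (k + 1) = (List.finRange n).take k ++ [⟨k, hk⟩] := by
  rw [List.take_succ_eq_append_getElem (by simpa using hk)]
  simp

lemma flatMap_filter {α β : Type*} (p : α → Prop) [DecidablePred p] (f : α → List β) (l : List α) :
    (l.filter p).flatMap f = l.flatMap fun a => if p a then f a else [] := by
  induction l with
  | nil => rfl
  | cons a l ih => by_cases h : p a <;> simp [h, ih]

namespace CNOTCircuit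

lemma encode_append {n : ℕ} (C D : CNOTCircuit (Fin n)) :
    CNOTCircuit.encode (C ++ D) = C.encode ++ D.encode :=
  List.flatMap_append

lemma encode_gate {n : ℕ} (a b : Fin n) :
    (gate a b).encode = if (a : ℕ) = b then [] else [(a : ℕ), (b : ℕ)] := by
  by_cases h : a = b <;> simp [gate, encode, h, Fin.val_inj]

end CNOTCircuit

/-- The state `s'` is `s` with the circuit `C` appended to the output and with arbitrary changes to
the registers from `r` on. -/
structure RAMState.Writes {n : ℕ} (r : ℕ) (C : CNOTCircuit (Fin n)) (s s' : RAMState) : Prop where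
  reg : ∀ k < r, s'.reg k = s.reg k
  arr : s'.arr = s.arr
  out : s'.out = s.out ++ C.encode

namespace RAMState.Writes

variable {n r r' : ℕ} {C D : CNOTCircuit (Fin n)} {s s' s'' : RAMState}

lemma refl : Writes r ([] : CNOTCircuit (Fin n)) s s :=
  ⟨fun _ _ => rfl, rfl, (List.append_nil _).symm⟩

lemma trans (h : Writes r C s s') (h' : Writes r D s' s'') : Writes r (C ++ D) s s'' where
  reg k hk := (h'.reg k hk).trans (h.reg k hk)
  arr := h'.arr.trans h.arr
  out := by rw [h'.out, h.out, CNOTCircuit.encode_append, List.append_assoc]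

lemma mono (h : Writes r C s s') (hr : r' ≤ r) : Writes r' C s s' :=
  ⟨fun k hk => h.reg k (hk.trans_le hr), h.arr, h.out⟩

lemma setReg (h : Writes r C s s') (hr : r ≤ r') (x : ℕ) : Writes r C s (s'.setReg r' x) where
  reg k hk := by rw [reg_setReg, if_neg (hk.trans_le hr).ne, h.reg k hk]
  arr := h.arr
  out := h.out

end RAMState.Writes

open CNOTCircuit RAMState RAMProgram

lemma RAMExpr.eval_emit (s : RAMState) (x : ℕ) (e : RAMExpr) : e.eval (s.emit x) = e.eval s := by
  induction e <;> simp_all [eval]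

namespace RAMProgram

/-- Write the gate with control `e` and target `f`, if `e ≠ f`. -/
def writeGate (e f : RAMExpr) : RAMProgram :=
  ifEq e f .skip (.seq (.write e) (.write f))

variable {n : ℕ} {s : RAMState}

lemma ends_forLoop_writes {N r t : ℕ} {e : RAMExpr} {p : RAMProgram}
    (c : Fin N → CNOTCircuit (Fin n))
    (he : ∀ C s', Writes r (n := n) C s s' → e.eval s' = N)
    (hbody : ∀ (k : Fin N) C s', Writes r (n := n) C s s' → s'.reg r = k →
      Ends p t s' (Writes (r + 1) (c k) s')) :
    Ends (forLoop r e p) (N * (t + 2) + 2) s (Writes r ((List.finRange N).flatMap c) s) := by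
  refine Ends.imp (Ends.forLoop (fun k => Writes r (((List.finRange N).take k).flatMap c) s) N
    (fun k s' x h => h.setReg le_rfl x) (fun k s' h => he _ s' h) ?_ ?_) ?_
  · intro k s' hk h hr
    refine (hbody ⟨k, hk⟩ _ s' h hr).imp fun s'' h' =>
      ⟨?_, (h'.reg r r.lt_succ_self).trans hr⟩
    rw [take_finRange_succ hk, List.flatMap_append, List.flatMap_singleton]
    exact h.trans (h'.mono r.le_succ)
  · exact Writes.refl
  · intro s' h
    rwa [List.take_of_length_le (List.length_finRange).le] at h

lemma ends_writeGate (r : ℕ) {e f : RAMExpr} {a b : Fin n} (ha : e.eval s = a)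
    (hb : f.eval s = b) : Ends (writeGate e f) 4 s (Writes r (gate a b) s) := by
  refine Ends.ifEq (t := 2) (fun h => (Ends.skip ?_).of_le one_le_two)
    fun h => Ends.seq (t := 1) (t' := 1) (Ends.write (Ends.write ?_))
  all_goals rw [ha, hb] at h; refine ⟨fun _ _ => rfl, rfl, ?_⟩
  · rw [encode_gate, if_pos h, List.append_nil]
  · rw [encode_gate, if_neg h, out_emit, out_emit, RAMExpr.eval_emit, ha, hb, List.append_assoc,
      List.singleton_append]

/-- The number that stands for an optional vertex in the programs: `0` for none, and `i + 1` for the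
vertex `i`. -/
def code (o : Option (Fin n)) : ℕ := ((finSuccEquiv n).symm o : ℕ)

/-- Write the gate from the vertex coded by register `5`, if there is one, to register `4`. -/
def writeLoad : RAMProgram :=
  .ifLt (.const 0) (.reg 5) (writeGate (.sub (.reg 5) (.const 1)) (.reg 4)) .skip

@[simp] lemma code_none : code (none : Option (Fin n)) = 0 := by
  simp [code]

@[simp] lemma code_some (i : Fin n) : code (some i) = i + 1 := by
  simp [code]

lemma code_inj {o o' : Option (Fin n)} : code o = code o' ↔ o = o' := by
  rw [code, code, Fin.val_inj, EmbeddingLike.apply_eq_iff_eq]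

lemma ends_writeLoad (r : ℕ) {o : Option (Fin n)} {v : Fin n} (ho : s.reg 5 = code o)
    (hv : s.reg 4 = v) : Ends writeLoad 5 s (Writes r (load o v) s) := by
  cases o with
  | none =>
    exact Ends.ifLt (fun h => by simp [RAMExpr.eval, ho] at h) fun _ =>
      (Ends.skip Writes.refl).of_le (by norm_num)
  | some i =>
    exact Ends.ifLt (fun _ => ends_writeGate r (by simp [RAMExpr.eval, ho]) hv) fun h => by
      simp [RAMExpr.eval, ho] at h

end RAMProgram

namespace RAMState

/-- The state `s` holds the sweep `S` over `G`, its circuit written as the output, and labels below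
the number `N` in register `1`. -/
structure Represents {n : ℕ} (N : ℕ) (G : SimpleGraph (Fin n)) [DecidableRel G.Adj]
    (label : Fin n → ℕ) (S : Sweep n) (s : RAMState) : Prop where
  size : s.reg 0 = n
  range : s.reg 1 = N
  adj : ∀ u v : Fin n, s.arr 0 (u * n + v) = if G.Adj u v then 1 else 0
  label : ∀ v : Fin n, s.arr 1 v = label v
  last : ∀ v : Fin n, s.arr 2 v = code (S.last v)
  done : ∀ v : Fin n, s.arr 3 v = (S.done v).toNat
  out : s.out = S.circuit.encode

/-- The registers `3` and `4` hold the vertex `v` and the start of its row in the adjacency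
matrix. -/
structure AtVertex {n : ℕ} (v : Fin n) (s : RAMState) : Prop where
  row : s.reg 3 = v * n
  vertex : s.reg 4 = v

section

variable {n N r : ℕ} {G : SimpleGraph (Fin n)} [DecidableRel G.Adj] {label : Fin n → ℕ}
  {S : Sweep n} {s s' : RAMState}

lemma Represents.of_writes (h : Represents N G label S s) {C : CNOTCircuit (Fin n)}
    (hw : Writes r C s s') (hr : 2 ≤ r) :
    Represents N G label { S with circuit := S.circuit ++ C } s' where
  size := (hw.reg 0 (by omega)).trans h.size
  range := (hw.reg 1 hr).trans h.range
  adj := hw.arr ▸ h.adj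
  label := hw.arr ▸ h.label
  last := hw.arr ▸ h.last
  done := hw.arr ▸ h.done
  out := by rw [hw.out, h.out, encode_append]

lemma Represents.setReg (h : Represents N G label S s) (hr : 2 ≤ r) (x : ℕ) :
    Represents N G label S (s.setReg r x) where
  size := by rw [reg_setReg, if_neg (by omega), h.size]
  range := by rw [reg_setReg, if_neg (by omega), h.range]
  adj := h.adj
  label := h.label
  last := h.last
  done := h.done
  out := h.out

lemma Represents.setArr_label (h : Represents N G label S s) (v : Fin n) (x : ℕ) :
    Represents N G (Function.update label v x) S (s.setArr 1 v x) where
  size := h.size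
  range := h.range
  adj := by simpa using h.adj
  label w := by simp [Function.update_apply, Fin.val_inj, h.label]
  last := by simpa using h.last
  done := by simpa using h.done
  out := h.out

lemma Represents.setArr_last (h : Represents N G label S s) (v : Fin n) (o : Option (Fin n)) :
    Represents N G label { S with last := Function.update S.last v o }
      (s.setArr 2 v (code o)) where
  size := h.size
  range := h.range
  adj := by simpa using h.adj
  label := by simpa using h.label
  last w := by by_cases hw : w = v <;> simp [hw, Fin.val_inj, h.last]
  done := by simpa using h.done
  out := h.out

lemma Represents.setArr_done (h : Represents N G label S s) (v : Fin n) (b : Bool) :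
    Represents N G label { S with done := Function.update S.done v b }
      (s.setArr 3 v b.toNat) where
  size := h.size
  range := h.range
  adj := by simpa using h.adj
  label := by simpa using h.label
  last := by simpa using h.last
  done w := by by_cases hw : w = v <;> simp [hw, Fin.val_inj, h.done]
  out := h.out

lemma AtVertex.congr {v : Fin n} (h : AtVertex v s) (hs : ∀ k < 5, s'.reg k = s.reg k) :
    AtVertex v s' :=
  ⟨(hs 3 (by norm_num)).trans h.row, (hs 4 (by norm_num)).trans h.vertex⟩

end

end RAMState

namespace RAMProgram

/-- Run `p` if the vertex in register `7` is an untreated neighbour of the vertex in register `4`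
whose most recently treated neighbour has the code in register `5`, and `q` otherwise. -/
def guestTest (p q : RAMProgram) : RAMProgram :=
  .ifLt (.add (.sub (.const 1) (.entry 0 (.add (.reg 3) (.reg 7)))) (.add (.entry 3 (.reg 7))
    (.add (.sub (.entry 2 (.reg 7)) (.reg 5)) (.sub (.reg 5) (.entry 2 (.reg 7)))))) (.const 1) p q

/-- Set register `6` to `1` if some vertex passes the test, and to `0` otherwise. -/
def findGuest : RAMProgram :=
  .seq (.assign 6 (.const 0)) (forLoop 7 (.reg 0) (guestTest (.assign 6 (.const 1)) .skip))

/-- Write gates from the vertex in register `4` to all vertices that pass the test. -/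
def fanOut : RAMProgram := forLoop 7 (.reg 0) (guestTest (writeGate (.reg 4) (.reg 7)) .skip)

/-- Write the gates of the exchange that belong to the code in register `5`. -/
def round : RAMProgram :=
  .seq findGuest (.ifLt (.const 0) (.reg 6) (.seq writeLoad (.seq fanOut writeLoad)) .skip)

/-- Write the gates of the exchange. -/
def rounds : RAMProgram := forLoop 5 (.add (.reg 0) (.const 1)) round

/-- Record the vertex in register `4` as the most recently treated neighbour of its neighbours. -/
def relabel : RAMProgram :=
  forLoop 5 (.reg 0) (.ifLt (.const 0) (.entry 0 (.add (.reg 3) (.reg 5)))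
    (.store 2 (.reg 5) (.add (.reg 4) (.const 1))) .skip)

/-- Treat the vertex in register `4`. -/
def treatVertex : RAMProgram :=
  .seq (.assign 5 (.entry 2 (.reg 4))) (.seq writeLoad (.seq rounds
    (.seq relabel (.store 3 (.reg 4) (.const 1)))))

/-- Treat the vertices whose label is in register `2`. -/
def treatBucket : RAMProgram :=
  .seq (.assign 3 (.const 0)) (forLoop 4 (.reg 0)
    (.seq (ifEq (.entry 1 (.reg 4)) (.reg 2) treatVertex .skip)
      (.assign 3 (.add (.reg 3) (.reg 0)))))

/-- Treat all vertices in the order given by the labels. -/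
def sweep : RAMProgram := forLoop 2 (.reg 1) treatBucket

section

variable {n N : ℕ} {G : SimpleGraph (Fin n)} [DecidableRel G.Adj] {label : Fin n → ℕ}
  {S : Sweep n} {s : RAMState} {v : Fin n}

section

variable {o : Option (Fin n)} (hS : Represents N G label S s) (hv : AtVertex v s)
  (ho : s.reg 5 = code o)

include hS hv ho

lemma ends_guestTest {p q : RAMProgram} {t : ℕ} {Q : RAMState → Prop} {w : Fin n}
    (hw : s.reg 7 = w) (hp : w ∈ (S.guests G v).filter (S.last · = o) → Ends p t s Q)
    (hq : w ∉ (S.guests G v).filter (S.last · = o) → Ends q t s Q) :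
    Ends (guestTest p q) (t + 1) s Q := by
  have htest : w ∈ (S.guests G v).filter (S.last · = o) ↔
      s.arr 0 (v * n + w) = 1 ∧ s.arr 3 w = 0 ∧ s.arr 2 w = s.reg 5 := by
    simp [Sweep.mem_guests, hS.adj, hS.done, hS.last, ho, code_inj, and_assoc]
  have hadj : s.arr 0 (v * n + w) ≤ 1 := by
    rw [hS.adj]
    split <;> norm_num
  refine Ends.ifLt (fun h => hp (htest.2 ?_)) fun h => hq fun hmem => h ?_
  · simp only [RAMExpr.eval, hw, hv.row] at h
    omega
  · simp only [RAMExpr.eval, hw, hv.row]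
    have := htest.1 hmem
    omega

lemma ends_findGuest : Ends findGuest (4 * n + 3) s fun s' =>
    Writes 6 ([] : CNOTCircuit (Fin n)) s s' ∧
      (0 < s'.reg 6 ↔ (S.guests G v).filter (S.last · = o) ≠ []) := by
  set L := (S.guests G v).filter (S.last · = o)
  refine Ends.of_le (Ends.seq (t := 1) (t' := n * (2 + 2) + 2) (Ends.assign ?_)) (by omega)
  refine Ends.imp (Ends.forLoop (fun k s' => Writes 6 ([] : CNOTCircuit (Fin n)) s s' ∧
    (0 < s'.reg 6 ↔ ∃ w ∈ L, (w : ℕ) < k)) n ?_ ?_ ?_ ?_) ?_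
  · rintro k s' x ⟨hw, h6⟩
    exact ⟨hw.setReg (by norm_num) x, by simpa using h6⟩
  · rintro k s' ⟨hw, -⟩
    exact (hS.of_writes hw (by norm_num)).size
  · rintro k s' hk ⟨hw, h6⟩ h7
    refine ends_guestTest (w := ⟨k, hk⟩) (hS.of_writes hw (by norm_num))
      (hv.congr fun i hi => hw.reg i (by omega)) ((hw.reg 5 (by norm_num)).trans ho) h7
      (fun hmem => Ends.assign ⟨⟨hw.setReg le_rfl _, ?_⟩, by simpa using h7⟩)
      fun hmem => Ends.skip ⟨⟨hw, h6.trans ?_⟩, h7⟩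
    · simpa [RAMExpr.eval] using ⟨_, hmem, le_rfl⟩
    · refine ⟨fun ⟨w, hwL, hwk⟩ => ⟨w, hwL, hwk.trans k.lt_succ_self⟩, fun ⟨w, hwL, hwk⟩ =>
        ⟨w, hwL, (Nat.le_of_lt_succ hwk).lt_of_ne fun h => hmem ?_⟩⟩
      subst h
      exact hwL
  · exact ⟨Writes.refl.setReg le_rfl _, by simp [RAMExpr.eval]⟩
  · rintro s' ⟨hw, h6⟩
    refine ⟨hw, h6.trans ?_⟩
    simp only [Fin.is_lt, and_true]
    exact ⟨fun ⟨_, hmem⟩ => List.ne_nil_of_mem hmem, List.exists_mem_of_ne_nil L⟩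

lemma ends_fanOut : Ends fanOut (7 * n + 2) s
    (Writes 7 (((S.guests G v).filter (S.last · = o)).flatMap (gate v)) s) := by
  set L := (S.guests G v).filter (S.last · = o) with hL
  have hfilter : L = (List.finRange n).filter (· ∈ L) := by
    rw [hL, Sweep.guests, List.filter_filter]
    exact List.filter_congr fun w _ => by simp
  have hflat : L.flatMap (gate v) =
      (List.finRange n).flatMap fun w => if w ∈ L then gate v w else [] := by
    conv_lhs => rw [hfilter, flatMap_filter]
  rw [hflat]
  refine Ends.of_le (ends_forLoop_writes (t := 5) _ (fun C s' hw => ?_) fun w C s' hw h7 => ?_)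
    (by omega)
  · exact (hS.of_writes hw (by norm_num)).size
  have hv' : AtVertex v s' := hv.congr fun i hi => hw.reg i (by omega)
  refine ends_guestTest (t := 4) (hS.of_writes hw (by norm_num)) hv'
    ((hw.reg 5 (by norm_num)).trans ho) h7 (fun hmem => ?_) fun hmem => ?_
  · rw [if_pos (show w ∈ L from hmem)]
    exact ends_writeGate 8 hv'.vertex h7
  · rw [if_neg (show w ∉ L from hmem)]
    exact (Ends.skip Writes.refl).of_le (by norm_num)

lemma ends_round : Ends round (11 * n + 16) s
    (Writes 6 (addVia o v ((S.guests G v).filter (S.last · = o))) s) := by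
  refine Ends.of_le (Ends.seq (t' := 7 * n + 13) ((ends_findGuest hS hv ho).imp ?_)) (by omega)
  rintro s' ⟨hw, h6⟩
  have hv' : AtVertex v s' := hv.congr fun i hi => hw.reg i (by omega)
  have ho' : s'.reg 5 = code o := (hw.reg 5 (by norm_num)).trans ho
  refine Ends.ifLt (fun h => ?_) fun h => ?_
  · rw [addVia, if_neg (h6.1 h)]
    refine Ends.of_le (Ends.seq (t := 5) (t' := 7 * n + 2 + 5) ?_) (by omega)
    refine (ends_writeLoad 6 ho' hv'.vertex).imp fun s₁ h₁ => Ends.seq ?_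
    have hv₁ : AtVertex v s₁ := hv'.congr fun i hi => h₁.reg i (by omega)
    have ho₁ : s₁.reg 5 = code o := (h₁.reg 5 (by norm_num)).trans ho'
    have hS₁ := (hS.of_writes hw (by norm_num)).of_writes h₁ (by norm_num)
    refine (ends_fanOut hS₁ hv₁ ho₁).imp fun s₂ h₂ => ?_
    refine (ends_writeLoad 6 ((h₂.reg 5 (by norm_num)).trans ho₁)
      ((h₂.reg 4 (by norm_num)).trans hv₁.vertex)).imp fun s₃ h₃ => ?_
    exact hw.trans (h₁.trans ((h₂.mono (by norm_num)).trans h₃))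
  · rw [addVia, if_pos (not_not.1 (mt h6.2 h))]
    exact (Ends.skip hw).of_le (by omega)

end

section

variable (hS : Represents N G label S s) (hv : AtVertex v s)

include hS hv

lemma ends_rounds : Ends rounds ((n + 1) * (11 * n + 18) + 2) s
    (Writes 5 (exchange S.last v (S.guests G v) ((List.finRange (n + 1)).map (finSuccEquiv n)))
      s) := by
  rw [exchange, List.flatMap_map]
  refine ends_forLoop_writes (t := 11 * n + 16) _ (fun C s' hw => ?_) fun k C s' hw h5 => ?_
  · simp [RAMExpr.eval, (hS.of_writes hw (by norm_num)).size]
  · have hS' := hS.of_writes hw (by norm_num)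
    have h := ends_round hS' (hv.congr hw.reg) (o := finSuccEquiv n k) (by simp [code, h5])
    exact h

lemma ends_relabel : Ends relabel (4 * n + 2) s fun s' =>
    Represents N G label { S with last := fun w => if G.Adj v w then some v else S.last w } s' ∧
      ∀ k < 5, s'.reg k = s.reg k := by
  let T (k : ℕ) : Sweep n :=
    { S with last := fun w => if (w : ℕ) < k ∧ G.Adj v w then some v else S.last w }
  refine Ends.of_le (t := n * (2 + 2) + 2) ?_ (by omega)
  refine Ends.imp (Ends.forLoop
    (fun k s' => Represents N G label (T k) s' ∧ ∀ k < 5, s'.reg k = s.reg k) n ?_ ?_ ?_ ?_) ?_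
  · rintro k s' x ⟨hS', hreg⟩
    exact ⟨hS'.setReg (by norm_num) x, fun i hi => by simp [hi.ne, hreg i hi]⟩
  · rintro k s' ⟨hS', -⟩
    exact hS'.size
  · rintro k s' hk ⟨hS', hreg⟩ h5
    have hv' := hv.congr hreg
    have hadj : 0 < s'.arr 0 (s'.reg 3 + s'.reg 5) ↔ G.Adj v ⟨k, hk⟩ := by
      have := hS'.adj v ⟨k, hk⟩
      by_cases h : G.Adj v ⟨k, hk⟩ <;> simp_all [hv'.row]
    have hT : T (k + 1) = ⟨Function.update (T k).last ⟨k, hk⟩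
        (if G.Adj v ⟨k, hk⟩ then some v else (T k).last ⟨k, hk⟩), S.done, S.circuit⟩ := by
      simp only [T, Sweep.mk.injEq, and_true]
      funext w
      by_cases hw : w = ⟨k, hk⟩
      · simp [hw]
      · have : (w : ℕ) < k + 1 ↔ (w : ℕ) < k := by grind
        simp [hw, this]
    rw [hT]
    refine Ends.ifLt (fun h => Ends.store ⟨⟨?_, hreg⟩, h5⟩) fun h => Ends.skip ⟨⟨?_, hreg⟩, h5⟩
    · rw [if_pos (hadj.1 h)]
      simpa [RAMExpr.eval, h5, hv'.vertex] using hS'.setArr_last ⟨k, hk⟩ (some v)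
    · rwa [if_neg (mt hadj.2 h), Function.update_eq_self]
  · simpa [T] using hS
  · simp [T]

lemma ends_treatVertex : Ends treatVertex ((n + 1) * (11 * n + 18) + 4 * n + 11) s fun s' =>
    Represents N G label (S.treat G v) s' ∧ ∀ k < 5, s'.reg k = s.reg k := by
  set t := (n + 1) * (11 * n + 18) + 2
  refine Ends.of_le (t := 1 + (5 + (t + (4 * n + 2 + 1)))) (Ends.seq (Ends.assign ?_)) (by omega)
  set s₀ := s.setReg 5 (RAMExpr.eval s (.entry 2 (.reg 4))) with hs₀
  have hS₀ : Represents N G label S s₀ := hS.setReg (by norm_num) _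
  have hv₀ : AtVertex v s₀ := hv.congr fun k hk => by simp [hs₀, hk.ne]
  have h5 : s₀.reg 5 = code (S.last v) := by simp [hs₀, RAMExpr.eval, hv.vertex, hS.last]
  refine Ends.seq ((ends_writeLoad 5 h5 hv₀.vertex).imp fun s₁ h₁ => Ends.seq ?_)
  have hS₁ := hS₀.of_writes h₁ (by norm_num)
  have hv₁ := hv₀.congr h₁.reg
  refine (ends_rounds hS₁ hv₁).imp fun s₂ h₂ => Ends.seq ?_
  refine (ends_relabel (hS₁.of_writes h₂ (by norm_num)) (hv₁.congr h₂.reg)).imp fun s₃ h₃ =>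
    Ends.store ?_
  obtain ⟨hS₃, hreg⟩ := h₃
  have hkeep : ∀ k < 5, s₃.reg k = s.reg k := fun k hk => by
    rw [hreg k hk, h₂.reg k hk, h₁.reg k hk, hs₀, reg_setReg, if_neg hk.ne]
  refine ⟨?_, hkeep⟩
  have hdone := hS₃.setArr_done v true
  rw [← (hv.congr hkeep).vertex] at hdone
  exact hdone

end

end

section

variable {n N : ℕ} {G : SimpleGraph (Fin n)} [DecidableRel G.Adj] {label : Fin n → Fin N}
  {S : Sweep n} {s : RAMState}

lemma ends_treatBucket (hS : Represents N G (label ·) S s) {b : Fin N} (hb : s.reg 2 = b) :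
    Ends treatBucket (n * ((n + 1) * (11 * n + 18) + 4 * n + 16) + 3) s fun s' =>
      Represents N G (label ·) (((List.finRange n).filter (label · = b)).foldl (Sweep.treat G) S)
        s' ∧ s'.reg 2 = b := by
  set t := (n + 1) * (11 * n + 18) + 4 * n + 11 with ht
  refine Ends.of_le (t := 1 + (n * (t + 2 + 1 + 2) + 2)) (Ends.seq (Ends.assign ?_))
    (by rw [ht, add_comm 1])
  refine Ends.imp (Ends.forLoop (fun k s' => Represents N G (label ·)
    ((((List.finRange n).take k).filter (label · = b)).foldl (Sweep.treat G) S) s' ∧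
      s'.reg 2 = b ∧ s'.reg 3 = k * n) n ?_ ?_ ?_ ?_) ?_
  · rintro k s' x ⟨hS', h2, h3⟩
    exact ⟨hS'.setReg (by norm_num) x, by simpa using h2, by simpa using h3⟩
  · rintro k s' ⟨hS', -⟩
    exact hS'.size
  · rintro k s' hk ⟨hS', h2, h3⟩ h4
    have hlabel : s'.arr 1 (s'.reg 4) = s'.reg 2 ↔ label ⟨k, hk⟩ = b := by
      rw [h4, h2, ← Fin.val_inj, ← hS'.label]
    rw [take_finRange_succ hk, List.filter_append, List.foldl_append]
    refine Ends.seq (t := t + 2) (t' := 1) (Ends.ifEq (fun h => ?_) fun h => ?_)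
    · refine (ends_treatVertex (v := ⟨k, hk⟩) hS' ⟨h3, h4⟩).imp fun s'' ⟨hS'', hreg⟩ =>
        Ends.assign ?_
      refine ⟨⟨?_, ?_, ?_⟩, ?_⟩
      · simpa [hlabel.1 h] using hS''.setReg (by norm_num) _
      · simp [hreg, h2]
      · simp [RAMExpr.eval, hreg, h3, hS'.size, add_mul]
      · simp [hreg, h4]
    · refine Ends.of_le (Ends.skip (Ends.assign ⟨⟨?_, ?_, ?_⟩, ?_⟩)) (by omega)
      · simpa [mt hlabel.2 h] using hS'.setReg (by norm_num) _
      · simp [h2]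
      · simp [RAMExpr.eval, h3, hS'.size, add_mul]
      · simp [h4]
  · exact ⟨by simpa using hS.setReg (by norm_num) _, by simpa using hb, by simp [RAMExpr.eval]⟩
  · rintro s' ⟨hS', h2, -⟩
    rw [List.take_of_length_le (List.length_finRange).le] at hS'
    exact ⟨hS', h2⟩

lemma ends_sweep (hS : Represents N G (label ·) (Sweep.start n) s) :
    Ends sweep (N * (n * ((n + 1) * (11 * n + 18) + 4 * n + 16) + 5) + 2) s fun s' =>
      s'.out = (Sweep.network G label).encode := by
  refine Ends.imp (Ends.forLoop (fun k s' => Represents N G (label ·)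
    ((((List.finRange N).take k).flatMap fun b => (List.finRange n).filter (label · = b)).foldl
      (Sweep.treat G) (Sweep.start n)) s') N ?_ ?_ ?_ ?_) ?_
  · exact fun k s' x hS' => hS'.setReg le_rfl x
  · exact fun k s' hS' => hS'.range
  · intro k s' hk hS' h2
    rw [take_finRange_succ hk, List.flatMap_append, List.flatMap_singleton, List.foldl_append]
    exact ends_treatBucket hS' (b := ⟨k, hk⟩) h2
  · exact hS
  · intro s' hS'
    rw [List.take_of_length_le (List.length_finRange).le] at hS'
    exact hS'.out

end

end RAMProgram

namespace RAMState

/-- The labels below `2 ^ L` that the coins `cs` give to `n` vertices: the coins `v * L, …,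
v * L + L - 1` are the bits of the label of `v`; coins beyond the end of `cs` show `0`. -/
def readLabel {n : ℕ} (L : ℕ) (cs : List Bool) (v : Fin n) : ℕ :=
  ∑ j : Fin L, (cs.getD (finProdFinEquiv (v, j)) false).toNat * 2 ^ (j : ℕ)

/-- The first `m` of the coins `cs` are tossed and the labels that they determine are stored. -/
structure Tossed {n : ℕ} (G : SimpleGraph (Fin n)) [DecidableRel G.Adj] (L : ℕ) (cs : List Bool)
    (m : ℕ) (s : RAMState) : Prop where
  represents : Represents (2 ^ L) G (readLabel L (cs.take m)) (Sweep.start n) s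
  coins : s.coins = cs.drop m

section

variable {n L R m : ℕ} {G : SimpleGraph (Fin n)} [DecidableRel G.Adj] {cs : List Bool}
  {s : RAMState}

lemma Represents.setCoins {N : ℕ} {label : Fin n → ℕ} {S : Sweep n}
    (h : Represents N G label S s) (l : List Bool) : Represents N G label S (s.setCoins l) :=
  ⟨h.size, h.range, h.adj, h.label, h.last, h.done, h.out⟩

lemma Tossed.setReg {r : ℕ} (h : Tossed G L cs m s) (hr : 2 ≤ r) (x : ℕ) :
    Tossed G L cs m (s.setReg r x) :=
  ⟨h.represents.setReg hr x, h.coins⟩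

lemma readLabel_append_singleton {k : Fin n} {l : Fin L}
    (hc : cs.length = (finProdFinEquiv (k, l) : ℕ)) (b : Bool) :
    (readLabel L (cs ++ [b]) : Fin n → ℕ) =
      Function.update (readLabel L cs) k (readLabel L cs k + b.toNat * 2 ^ (l : ℕ)) := by
  have hget (v : Fin n) (j : Fin L) : ((cs ++ [b]).getD (finProdFinEquiv (v, j)) false).toNat =
      (cs.getD (finProdFinEquiv (v, j)) false).toNat + if v = k ∧ j = l then b.toNat else 0 := by
    have hpos : v = k ∧ j = l ↔ (finProdFinEquiv (v, j) : ℕ) = cs.length := by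
      rw [hc, Fin.val_inj, EmbeddingLike.apply_eq_iff_eq, Prod.mk.injEq]
    simp only [hpos, List.getD_eq_getElem?_getD, List.getElem?_append, List.getElem?_singleton]
    grind
  funext v
  simp only [readLabel, hget, add_mul, Finset.sum_add_distrib, Function.update_apply]
  by_cases hv : v = k <;> simp [hv, ite_mul]

lemma readLabel_take_succ {k : Fin n} {l : Fin L} {m : ℕ} (hm : m < cs.length)
    (hkl : m = (finProdFinEquiv (k, l) : ℕ)) :
    (readLabel L (cs.take (m + 1)) : Fin n → ℕ) = Function.update (readLabel L (cs.take m)) k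
      (readLabel L (cs.take m) k + cs[m].toNat * 2 ^ (l : ℕ)) := by
  rw [← readLabel_append_singleton (by rw [← hkl, List.length_take_of_le hm.le]),
    List.take_append_getElem]

lemma readLabel_take_ofFn (hR : n * L ≤ R) (ω : Fin R → Bool) :
    readLabel L ((List.ofFn ω).take (n * L)) = fun v => (Sweep.coinLabel hR ω v : ℕ) := by
  funext v
  rw [Sweep.coinLabel_val, readLabel]
  refine Finset.sum_congr rfl fun j _ => ?_
  have hlt := (finProdFinEquiv (v, j)).isLt
  simp [-finProdFinEquiv_apply_val, List.getD_eq_getElem?_getD, hlt, hlt.trans_le hR]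
  rfl

lemma arr_init_zero (u v : Fin n) :
    (init G cs).arr 0 (u * n + v) = if G.Adj u v then 1 else 0 := by
  refine if_congr ⟨?_, fun h => ⟨rfl, u, v, h, rfl⟩⟩ rfl rfl
  rintro ⟨-, i, j, hij, heq⟩
  have hpair : finProdFinEquiv (u, v) = finProdFinEquiv (i, j) := by
    refine Fin.ext ?_
    simpa only [finProdFinEquiv_apply_val, mul_comm, add_comm] using heq
  obtain ⟨rfl, rfl⟩ := Prod.mk_inj.1 (finProdFinEquiv.injective hpair)
  exact hij

lemma tossed_zero (hs : s.reg 0 = n) (hr : s.reg 1 = 2 ^ L) (ha : s.arr = (init G cs).arr)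
    (hc : s.coins = cs) (ho : s.out = []) : Tossed G L cs 0 s where
  represents :=
    { size := hs
      range := hr
      adj := fun u v => by rw [ha, arr_init_zero]
      label := fun v => by simp [ha, init, readLabel]
      last := fun v => by simp [ha, init, Sweep.start, code]
      done := fun v => by simp [ha, init, Sweep.start]
      out := ho }
  coins := hc

end

end RAMState

namespace RAMProgram

/-- Set register `1` to the least power of two that is at least the number of vertices. -/
def findRange : RAMProgram :=
  .seq (.assign 1 (.const 1)) (.whileLt (.reg 1) (.reg 0) (.assign 1 (.add (.reg 1) (.reg 1))))

/-- Toss the coin for the bit of value `2 ^ l`, stored in register `5`, of the label of the vertex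
in register `4`. -/
def tossBit : RAMProgram :=
  .seq (.coin 6) (.seq (.ifLt (.const 0) (.reg 6)
    (.store 1 (.reg 4) (.add (.entry 1 (.reg 4)) (.reg 5))) .skip)
      (.assign 5 (.add (.reg 5) (.reg 5))))

/-- Toss the coins for the labels of all vertices. -/
def tossLabels : RAMProgram :=
  forLoop 4 (.reg 0) (.seq (.assign 5 (.const 1)) (.whileLt (.reg 5) (.reg 1) tossBit))

/-- Treat the vertices in the order given by random labels. -/
def randomSweep : RAMProgram := .seq findRange (.seq tossLabels sweep)

variable {n L R : ℕ} {G : SimpleGraph (Fin n)} [DecidableRel G.Adj] {cs : List Bool} {s : RAMState}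

lemma ends_findRange :
    Ends findRange (2 * Nat.clog 2 n + 2) (init G cs) (Tossed G (Nat.clog 2 n) cs 0) := by
  set L := Nat.clog 2 n
  refine Ends.of_le (Ends.seq (t := 1) (t' := L * (1 + 1) + 1) (Ends.assign ?_)) (by omega)
  refine Ends.imp (Ends.whileLt (fun k s => s.reg 0 = n ∧ s.reg 1 = 2 ^ k ∧
    s.arr = (init G cs).arr ∧ s.coins = cs ∧ s.out = []) L ?_ ?_ ?_) ?_
  · rintro k s - ⟨hs, hr, -⟩
    simp only [RAMExpr.eval, hs, hr]
    exact (Nat.lt_clog_iff_pow_lt one_lt_two).symm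
  · rintro k s - ⟨hs, hr, h⟩
    exact Ends.assign ⟨by simpa using hs, by simp [RAMExpr.eval, hr, pow_succ, mul_two], h⟩
  · exact ⟨by simp [init], by simp [RAMExpr.eval], rfl, rfl, rfl⟩
  · exact fun s ⟨hs, hr, ha, hc, ho⟩ => tossed_zero hs hr ha hc ho

lemma ends_tossBit {k : Fin n} {l : Fin L} (hlen : n * L ≤ cs.length)
    (hs : Tossed G L cs (L * k + l) s) (h4 : s.reg 4 = k) (h5 : s.reg 5 = 2 ^ (l : ℕ)) :
    Ends tossBit 4 s fun s' =>
      Tossed G L cs (L * k + l + 1) s' ∧ s'.reg 4 = k ∧ s'.reg 5 = 2 ^ ((l : ℕ) + 1) := by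
  have hpos : L * k + l = (finProdFinEquiv (k, l) : ℕ) := by
    rw [finProdFinEquiv_apply_val, add_comm]
  have hm : L * k + l < cs.length := hpos ▸ (Fin.is_lt _).trans_le hlen
  have hlabel := readLabel_take_succ (cs := cs) hm hpos
  set b := cs[L * k + l]
  set label := readLabel (n := n) L (cs.take (L * k + l))
  refine Ends.seq (t := 1) (t' := 3) (Ends.coin (hs.coins.trans (List.drop_eq_getElem_cons hm)) ?_)
  set s₁ := (s.setReg 6 b.toNat).setCoins (cs.drop (L * k + l + 1)) with hs₁
  have hS₁ : Represents (2 ^ L) G label (Sweep.start n) s₁ :=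
    (hs.represents.setReg (r := 6) (by norm_num) b.toNat).setCoins _
  refine Ends.seq (t := 2) (t' := 1) (Ends.imp (Q := fun s' => Tossed G L cs (L * k + l + 1) s' ∧
    s'.reg 4 = k ∧ s'.reg 5 = 2 ^ (l : ℕ)) (Ends.ifLt (fun h => ?_) fun h => ?_) ?_)
  · have hb1 : b.toNat = 1 := by
      have hpos : 0 < b.toNat := by simpa [RAMExpr.eval, hs₁] using h
      exact b.toNat_le.antisymm hpos
    refine Ends.store ⟨⟨?_, rfl⟩, h4, h5⟩
    have hstored := hS₁.setArr_label k (label k + b.toNat * 2 ^ (l : ℕ))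
    rw [← hlabel, ← hS₁.label] at hstored
    simpa [RAMExpr.eval, hs₁, h4, h5, hb1] using hstored
  · have hb0 : b.toNat = 0 := by simpa [RAMExpr.eval, hs₁] using h
    rw [hb0, zero_mul, add_zero, Function.update_eq_self] at hlabel
    exact Ends.skip ⟨⟨hlabel ▸ hS₁, rfl⟩, h4, h5⟩
  · rintro s' ⟨hs', h4', h5'⟩
    exact Ends.assign ⟨hs'.setReg (by norm_num) _, by simpa using h4',
      by simp [RAMExpr.eval, h5', pow_succ, mul_two]⟩

lemma ends_tossLabels (hlen : n * L ≤ cs.length) (hs : Tossed G L cs 0 s) :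
    Ends tossLabels (n * (5 * L + 4) + 2) s (Tossed G L cs (n * L)) := by
  refine Ends.imp (Ends.forLoop (t := 5 * L + 2) (fun k s => Tossed G L cs (L * k) s) n ?_ ?_ ?_ ?_)
    fun s h => mul_comm L n ▸ h
  · exact fun k s x hs => hs.setReg (by norm_num) x
  · exact fun k s hs => hs.represents.size
  · intro k s hk hs h4
    refine Ends.of_le (t := 1 + (L * (4 + 1) + 1)) (Ends.seq (Ends.assign ?_)) (by omega)
    refine Ends.imp (Ends.whileLt (fun l s => Tossed G L cs (L * k + l) s ∧ s.reg 4 = k ∧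
      s.reg 5 = 2 ^ l) L ?_ ?_ ?_) fun s' ⟨hs', h4', _⟩ => ⟨hs', h4'⟩
    · rintro l s - ⟨hs, -, h5⟩
      simp only [RAMExpr.eval, h5, hs.represents.range]
      exact Nat.pow_lt_pow_iff_right one_lt_two
    · rintro l s hl ⟨hs, h4, h5⟩
      exact ends_tossBit (k := ⟨k, hk⟩) (l := ⟨l, hl⟩) hlen hs h4 h5
    · exact ⟨hs.setReg (by norm_num) _, by simpa using h4, by simp [RAMExpr.eval]⟩
  · exact hs

/-- A bound on the number of steps of `randomSweep` on graphs with `n` vertices. -/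
noncomputable def timeBound : Polynomial ℕ := 100 * (Polynomial.X + 1) ^ 4

lemma eval_timeBound (n : ℕ) : timeBound.eval n = 100 * (n + 1) ^ 4 := by
  simp [timeBound]

lemma clog_le_self (n : ℕ) : Nat.clog 2 n ≤ n :=
  (Nat.clog_le_iff_le_pow one_lt_two).2 Nat.lt_two_pow_self.le

lemma mul_clog_le_eval_timeBound (n : ℕ) : n * Nat.clog 2 n ≤ timeBound.eval n := by
  rw [eval_timeBound]
  nlinarith [Nat.mul_le_mul_left n (clog_le_self n), Nat.zero_le (n ^ 3), Nat.zero_le (n ^ 4)]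

lemma ends_randomSweep (hR : n * Nat.clog 2 n ≤ R) (ω : Fin R → Bool) :
    Ends randomSweep (timeBound.eval n) (init G (List.ofFn ω)) fun s =>
      s.out = (Sweep.network G (Sweep.coinLabel hR ω)).encode := by
  refine Ends.of_le (Ends.seq (ends_findRange.imp fun s hs => Ends.seq
    ((ends_tossLabels (by simpa using hR) hs).imp fun s' hs' => ends_sweep ?_))) ?_
  · rw [← readLabel_take_ofFn hR ω]
    exact hs'.represents
  · have hclog := clog_le_self n
    have hpow : 2 ^ Nat.clog 2 n ≤ 2 * n + 1 := by
      rcases n.eq_zero_or_pos with rfl | hn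
      · simp
      · linarith [Sweep.two_pow_clog_le hn]
    rw [eval_timeBound]
    calc _ ≤ 2 * n + 2 + (n * (5 * n + 4) + 2 +
          ((2 * n + 1) * (n * ((n + 1) * (11 * n + 18) + 4 * n + 16) + 5) + 2)) := by gcongr
      _ ≤ 100 * (n + 1) ^ 4 := by
        nlinarith [Nat.zero_le (n ^ 2), Nat.zero_le (n ^ 3), Nat.zero_le (n ^ 4)]

end RAMProgram

lemma rpow_mul_le_mul_sqrt_log (K : ℝ) {n : ℕ} (hn : 1 < n) :
    K * (n : ℝ) ^ (3 / 2 : ℝ) ≤ 2 * |K| * ((n : ℝ) ^ (3 / 2 : ℝ) * √(Real.log n)) := by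
  have hsqrt : 1 / 2 ≤ √(Real.log n) :=
    Real.le_sqrt_of_sq_le (by linarith [Sweep.half_le_log hn])
  calc K * (n : ℝ) ^ (3 / 2 : ℝ) ≤ |K| * (n : ℝ) ^ (3 / 2 : ℝ) := by gcongr; exact le_abs_self K
    _ = 2 * |K| * ((n : ℝ) ^ (3 / 2 : ℝ) * (1 / 2)) := by ring
    _ ≤ 2 * |K| * ((n : ℝ) ^ (3 / 2 : ℝ) * √(Real.log n)) := by gcongr

lemma expectedSize_le_mul_sqrt_log {n R : ℕ} {m K : ℝ} (hm : 0 ≤ m)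
    {C : (Fin R → Bool) → CNOTCircuit (Fin n)}
    (hC : ∀ ω, ((C ω).length : ℝ) ≤ m + K * (n : ℝ) ^ (3 / 2 : ℝ)) :
    expectedSize C ≤ m + 2 * |K| * ((n : ℝ) ^ (3 / 2 : ℝ) * √(Real.log n)) := by
  refine Finset.expect_le Finset.univ_nonempty fun ω _ => ?_
  rcases Nat.lt_or_ge 1 n with hn | hn
  · linarith [hC ω, rpow_mul_le_mul_sqrt_log K hn]
  · have : Subsingleton (Fin n) := Fin.subsingleton_iff_le_one.2 hn
    rw [length_eq_zero, Nat.cast_zero]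
    positivity

theorem theorem3_general :
    ∃ (P : RAMProgram) (T : Polynomial ℕ)
      (C : ∀ (n : ℕ) (G : SimpleGraph (Fin n)) [DecidableRel G.Adj],
        (Fin (T.eval n) → Bool) → CNOTCircuit (Fin n)),
      (∀ (n : ℕ) (G : SimpleGraph (Fin n)) [DecidableRel G.Adj] (ω : Fin (T.eval n) → Bool),
        P.OutputsWithin G (List.ofFn ω) (T.eval n) (C n G ω) ∧
          (C n G ω).IsGraphicParityNetwork G) ∧
      (∃ K : ℝ, ∀ (n : ℕ) (G : SimpleGraph (Fin n)) [DecidableRel G.Adj]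
        (ω : Fin (T.eval n) → Bool),
        ((C n G ω).length : ℝ) ≤ (G.edgeFinset.card : ℝ) + K * (n : ℝ) ^ (3 / 2 : ℝ)) ∧
      (∀ (c₁ : ℕ) (c₂ : ℝ), 0 < c₂ → ∃ K : ℝ,
        ∀ (n : ℕ) (G : SimpleGraph (Fin n)) [DecidableRel G.Adj],
          (Finset.univ.filter fun v : Fin n => (G.degree v : ℝ) < c₂ * n).card ≤ c₁ →
            expectedSize (C n G) ≤ (G.edgeFinset.card : ℝ) + K * (n * Real.log n)) := by
  refine ⟨randomSweep, timeBound,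
    fun n G _ ω => Sweep.network G (Sweep.coinLabel (mul_clog_le_eval_timeBound n) ω), ?_, ?_, ?_⟩
  · exact fun n G _ ω =>
      ⟨ends_randomSweep _ ω, Sweep.isGraphicParityNetwork_network G _⟩
  · exact ⟨13, fun n G _ ω => Sweep.length_network_le_rpow G _⟩
  · exact fun c₁ c₂ hc₂ => ⟨22 + 4 * c₁ + 16 / c₂, fun n G _ hdeg =>
      Sweep.expectedSize_network_coinLabel_le G _ hc₂ hdeg⟩

theorem theorem3 :
    ∃ (P : RAMProgram) (T : Polynomial ℕ)
      (C : ∀ (n : ℕ) (G : SimpleGraph (Fin n)) [DecidableRel G.Adj],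
        (Fin (T.eval n) → Bool) → CNOTCircuit (Fin n)),
      -- in polynomial time, `P` always produces a graphic parity network, namely `C n G ω`
      (∀ (n : ℕ) (G : SimpleGraph (Fin n)) [DecidableRel G.Adj] (ω : Fin (T.eval n) → Bool),
        P.OutputsWithin G (List.ofFn ω) (T.eval n) (C n G ω) ∧
          (C n G ω).IsGraphicParityNetwork G) ∧
      -- its expected size on all graphs
      (∃ K : ℝ, ∀ (n : ℕ) (G : SimpleGraph (Fin n)) [DecidableRel G.Adj],
        expectedSize (C n G) ≤
          (G.edgeFinset.card : ℝ) + K * ((n : ℝ) ^ (3 / 2 : ℝ) * √(Real.log n))) ∧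
      -- its expected size if all but at most `c₁` vertices have degree at least `c₂ * n`
      (∀ (c₁ : ℕ) (c₂ : ℝ), 0 < c₂ → ∃ K : ℝ,
        ∀ (n : ℕ) (G : SimpleGraph (Fin n)) [DecidableRel G.Adj],
          (Finset.univ.filter fun v : Fin n => (G.degree v : ℝ) < c₂ * n).card ≤ c₁ →
            expectedSize (C n G) ≤ (G.edgeFinset.card : ℝ) + K * (n * Real.log n)) := by
  obtain ⟨P, T, C, hP, ⟨K, hK⟩, hlog⟩ := theorem3_general
  exact ⟨P, T, C, hP, ⟨2 * |K|, fun n G _ =>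
    expectedSize_le_mul_sqrt_log (Nat.cast_nonneg _) (hK n G)⟩, hlog⟩
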